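/- For a natural number $n$ let $\mathrm{nRC_{fin}}$ be the statement "for every infinite set $x$ there are an infinite subset $y\subseteq x$ and a function $f$ assigning to every finite $z\subseteq y$ with more than $n$ elements an $n$-element subset $f(z)\subseteq z$", and let $\mathrm{nC^-_{fin}}$ be the statement "for every infinite family $\mathcal F$ of finite sets with more than $n$ elements there are an infinite subfamily $\mathcal A\subseteq\mathcal F$ and a function $f$ assigning to every $z\in\mathcal A$ an $n$-element subset $f(z)\subseteq z$". For positive integers $n_1,\dots,n_l$ let $\mathcal V_{n_1,\dots,n_l}$ be the following permutation model. The set of atoms is the disjoint union of $l$ lines; the $k$-th line is the disjoint union of blocks $A^k_q$, $q\in\mathbb Q$, ordered like $\mathbb Q$, and each block $A^k_q$ is a cyclically arranged set of $n_k$ atoms. The group $G$ consists of all permutations $\pi$ of the atoms for which there are order automorphisms $\sigma_1,\dots,\sigma_l$ of $\mathbb Q$ such that, for all $k$ and $q$, $\pi$ maps $A^k_q$ onto $A^k_{\sigma_k(q)}$ preserving the cyclic arrangement. The normal ideal consists of all finite sets of atoms, so $\mathcal V_{n_1,\dots,n_l}$ is the class of those objects $x$ of the universe of sets over these atoms (a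 model of ZFA with choice) such that $x$ and every element of its transitive closure is fixed by all elements of $G$ that fix pointwise some finite set of atoms (depending on the object). Theorem. Let $l\in\omega$, let $p_1,\dots,p_l$ be distinct primes and let $a_1,\dots,a_l$ be natural numbers greater than $0$. Then for every $n\in\omega$ $$\mathcal V_{p_1^{a_1},\dots,p_l^{a_l}}\models \mathrm{nRC_{fin}}\iff \mathcal V_{p_1^{a_1},\dots,p_l^{a_l}}\models \mathrm{nC^-_{fin}}\iff n\text{ is a multiple of }\prod_{k=1}^l p_k^{a_k}.$$ -/

import Mathlib

universe u

/-! ## A universe of sets with atoms -/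

/-- Codes for sets over a type `A` of atoms (urelements): an atom, or a family of codes indexed by a
type in `Type u`. -/
inductive PreZFA (A : Type) : Type (u + 1)
  | atom (a : A) : PreZFA A
  | mk (ι : Type u) (f : ι → PreZFA A) : PreZFA A

namespace PreZFA

variable {A : Type}

/-- Extensional equality of codes: equal atoms, or the same elements up to extensional equality.
An atom is never equal to a set, in particular not to the empty set. -/
def Equiv : PreZFA.{u} A → PreZFA.{u} A → Prop
  | atom a, atom b => a = b
  | mk _ f, mk _ g => (∀ i, ∃ j, Equiv (f i) (g j)) ∧ (∀ j, ∃ i, Equiv (f i) (g j))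
  | atom _, mk _ _ => False
  | mk _ _, atom _ => False

theorem Equiv.refl : ∀ x : PreZFA.{u} A, Equiv x x
  | atom _ => by simp [Equiv]
  | mk _ f => by
    simp only [Equiv]
    exact ⟨fun i => ⟨i, Equiv.refl (f i)⟩, fun i => ⟨i, Equiv.refl (f i)⟩⟩

theorem Equiv.symm : ∀ {x y : PreZFA.{u} A}, Equiv x y → Equiv y x
  | atom _, atom _, h => by simp only [Equiv] at h ⊢; exact h.symm
  | mk _ f, mk _ g, h => by
    simp only [Equiv] at h ⊢
    refine ⟨fun j => ?_, fun i => ?_⟩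
    · obtain ⟨i, hi⟩ := h.2 j
      exact ⟨i, Equiv.symm hi⟩
    · obtain ⟨j, hj⟩ := h.1 i
      exact ⟨j, Equiv.symm hj⟩
  | atom _, mk _ _, h => by simp [Equiv] at h
  | mk _ _, atom _, h => by simp [Equiv] at h

theorem Equiv.trans : ∀ {x y z : PreZFA.{u} A}, Equiv x y → Equiv y z → Equiv x z
  | atom _, atom _, atom _, h, k => by simp only [Equiv] at h k ⊢; exact h.trans k
  | mk _ f, mk _ g, mk _ e, h, k => by
    simp only [Equiv] at h k ⊢
    refine ⟨fun i => ?_, fun l => ?_⟩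
    · obtain ⟨j, hj⟩ := h.1 i
      obtain ⟨l, hl⟩ := k.1 j
      exact ⟨l, Equiv.trans hj hl⟩
    · obtain ⟨j, hj⟩ := k.2 l
      obtain ⟨i, hi⟩ := h.2 j
      exact ⟨i, Equiv.trans hi hj⟩
  | atom _, mk _ _, _, h, _ => by simp [Equiv] at h
  | mk _ _, atom _, _, h, _ => by simp [Equiv] at h
  | _, atom _, mk _ _, _, k => by simp [Equiv] at k
  | _, mk _ _, atom _, _, k => by simp [Equiv] at k

instance setoid (A : Type) : Setoid (PreZFA.{u} A) :=
  ⟨Equiv, Equiv.refl, Equiv.symm, Equiv.trans⟩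

/-- `Mem x y`: the code `x` is, up to extensional equality, listed in `y`. Atoms have no elements. -/
def Mem (x : PreZFA.{u} A) : PreZFA.{u} A → Prop
  | atom _ => False
  | mk _ g => ∃ j, Equiv x (g j)

theorem Mem.congr {x x' y y' : PreZFA.{u} A} (hx : Equiv x x') (hy : Equiv y y') :
    Mem x y → Mem x' y' := by
  cases y <;> cases y' <;> simp only [Equiv, Mem] at hy ⊢
  · exact id
  · rintro ⟨j, hj⟩
    obtain ⟨k, hk⟩ := hy.1 j
    exact ⟨k, (hx.symm.trans hj).trans hk⟩

/-- Being an atom. -/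
def IsAtom : PreZFA.{u} A → Prop
  | atom _ => True
  | mk _ _ => False

theorem IsAtom.congr {x y : PreZFA.{u} A} (h : Equiv x y) : IsAtom x ↔ IsAtom y := by
  cases x <;> cases y <;> simp_all [Equiv, IsAtom]

/-- A permutation of the atoms acts on codes: `π x = {π y : y ∈ x}` for sets `x`. -/
def map (π : Equiv.Perm A) : PreZFA.{u} A → PreZFA.{u} A
  | atom a => atom (π a)
  | mk ι f => mk ι fun i => map π (f i)

theorem map_congr (π : Equiv.Perm A) :
    ∀ {x y : PreZFA.{u} A}, Equiv x y → Equiv (map π x) (map π y)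
  | atom _, atom _, h => by simp only [Equiv, map] at h ⊢; rw [h]
  | mk _ f, mk _ g, h => by
    simp only [Equiv, map] at h ⊢
    refine ⟨fun i => ?_, fun j => ?_⟩
    · obtain ⟨j, hj⟩ := h.1 i
      exact ⟨j, map_congr π hj⟩
    · obtain ⟨i, hi⟩ := h.2 j
      exact ⟨i, map_congr π hi⟩
  | atom _, mk _ _, h => by simp [Equiv] at h
  | mk _ _, atom _, h => by simp [Equiv] at h

theorem map_one : ∀ x : PreZFA.{u} A, map 1 x = x
  | atom _ => rfl
  | mk _ f => by simp only [map]; congr 1; funext i; exact map_one (f i)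

theorem map_mul (π ρ : Equiv.Perm A) :
    ∀ x : PreZFA.{u} A, map (π * ρ) x = map π (map ρ x)
  | atom _ => rfl
  | mk _ f => by simp only [map]; congr 1; funext i; exact map_mul π ρ (f i)

end PreZFA

/-- The universe of sets with atoms from `A` (the ground model of ZFA with choice): codes up to
extensional equality. -/
def ZFAUniverse (A : Type) : Type (u + 1) := Quotient (PreZFA.setoid.{u} A)

namespace ZFAUniverse

variable {A : Type}

/-- The atom `a` as an object of the universe. -/
def atom (a : A) : ZFAUniverse.{u} A := Quotient.mk _ (PreZFA.atom a)

/-- Membership. -/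
def Mem (x y : ZFAUniverse.{u} A) : Prop :=
  Quotient.liftOn₂ x y PreZFA.Mem fun _ _ _ _ hx hy =>
    propext ⟨PreZFA.Mem.congr hx hy, PreZFA.Mem.congr (PreZFA.Equiv.symm hx) (PreZFA.Equiv.symm hy)⟩

/-- Being an atom; the other objects are the sets. -/
def IsAtom (x : ZFAUniverse.{u} A) : Prop :=
  Quotient.liftOn x PreZFA.IsAtom fun _ _ h => propext (PreZFA.IsAtom.congr h)

/-- Permutations of the atoms act on the universe by `π x = {π y : y ∈ x}`. -/
instance (A : Type) : MulAction (Equiv.Perm A) (ZFAUniverse.{u} A) where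
  smul π := Quotient.map (PreZFA.map π) fun _ _ h => PreZFA.map_congr π h
  one_smul x := by
    induction x using Quotient.inductionOn with
    | h x => exact congrArg (Quotient.mk _) (PreZFA.map_one x)
  mul_smul π ρ x := by
    induction x using Quotient.inductionOn with
    | h x => exact congrArg (Quotient.mk _) (PreZFA.map_mul π ρ x)

/-- `x` is symmetric for the group `G` and the normal ideal of finite sets of atoms: some finite set
`E` of atoms supports `x`, that is, every element of `G` fixing all atoms of `E` fixes `x`. -/
def Symmetric (G : Subgroup (Equiv.Perm A)) (x : ZFAUniverse.{u} A) : Prop :=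
  ∃ E : Set A, E.Finite ∧ MulAction.Supports G E x

/-- `x` is symmetric, and so are all elements of `x`, all elements of these, and so on. -/
inductive HereditarilySymmetric (G : Subgroup (Equiv.Perm A)) : ZFAUniverse.{u} A → Prop
  | intro (x : ZFAUniverse.{u} A) (hx : Symmetric G x)
      (h : ∀ y, Mem y x → HereditarilySymmetric G y) : HereditarilySymmetric G x

end ZFAUniverse

/-! ## Structures for the language of ZFA, and the choice principles in them -/

/-- A structure for the language of ZFA: a domain with a binary relation (membership) and a unary
predicate (being an atom). -/
structure ZFAStructure : Type (u + 1) where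
  /-- the domain -/
  Dom : Type u
  /-- `mem x y`: `x` is an element of `y` -/
  mem : Dom → Dom → Prop
  /-- being an atom -/
  atom : Dom → Prop

namespace ZFAStructure

variable (M : ZFAStructure.{u})

/-- `x` is a set. -/
def IsSet (x : M.Dom) : Prop := ¬ M.atom x

/-- `x` and `y` are sets with `x ⊆ y`. -/
def Subset (x y : M.Dom) : Prop := M.IsSet x ∧ M.IsSet y ∧ ∀ w, M.mem w x → M.mem w y

/-- `w = {x, y}`. -/
def IsUnorderedPair (w x y : M.Dom) : Prop := M.IsSet w ∧ ∀ v, M.mem v w ↔ v = x ∨ v = y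

/-- `w = (x, y) = {{x}, {x, y}}`. -/
def IsPair (w x y : M.Dom) : Prop :=
  ∃ s t, M.IsUnorderedPair s x x ∧ M.IsUnorderedPair t x y ∧ M.IsUnorderedPair w s t

/-- `(x, y) ∈ f`. -/
def Maps (f x y : M.Dom) : Prop := ∃ w, M.IsPair w x y ∧ M.mem w f

/-- `f` is a function (a set of ordered pairs) with domain `{x | P x}`. -/
def IsFunctionOn (f : M.Dom) (P : M.Dom → Prop) : Prop :=
  M.IsSet f ∧ (∀ w, M.mem w f → ∃ x y, P x ∧ M.IsPair w x y) ∧ ∀ x, P x → ∃! y, M.Maps f x y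

/-- `x = ∅`. -/
def IsEmptySet (x : M.Dom) : Prop := M.IsSet x ∧ ∀ w, ¬ M.mem w x

/-- `y = x ∪ {x}`. -/
def IsSuccessor (y x : M.Dom) : Prop := M.IsSet y ∧ ∀ w, M.mem w y ↔ M.mem w x ∨ w = x

/-- `∅ ∈ I`, and `x ∪ {x} ∈ I` for all `x ∈ I`. -/
def IsInductive (I : M.Dom) : Prop :=
  M.IsSet I ∧ (∃ e, M.IsEmptySet e ∧ M.mem e I) ∧
    ∀ x, M.mem x I → ∃ y, M.IsSuccessor y x ∧ M.mem y I

/-- `m ∈ ω`, where `ω` is the least inductive set. -/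
def IsNatural (m : M.Dom) : Prop := ∀ I, M.IsInductive I → M.mem m I

/-- `g` is a bijection from `x` onto `y`. -/
def IsBijection (g x y : M.Dom) : Prop :=
  M.IsFunctionOn g (fun i => M.mem i x) ∧ (∀ i v, M.Maps g i v → M.mem v y) ∧
    ∀ v, M.mem v y → ∃! i, M.Maps g i v

/-- `x` is a finite set: in `M`, there is a bijection between a natural number and `x`. -/
def IsFiniteSet (x : M.Dom) : Prop := M.IsSet x ∧ ∃ m g, M.IsNatural m ∧ M.IsBijection g m x

/-- `x` is an infinite set: a set that is not finite in `M`. -/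
def IsInfiniteSet (x : M.Dom) : Prop := M.IsSet x ∧ ¬ M.IsFiniteSet x

/-- `x` is a set with exactly `n` elements. -/
def HasCard (x : M.Dom) (n : ℕ) : Prop := M.IsSet x ∧ {w | M.mem w x}.encard = n

/-- `x` is a finite set with more than `n` elements. -/
def IsFiniteSetOfCardGT (x : M.Dom) (n : ℕ) : Prop :=
  M.IsFiniteSet x ∧ (n : ℕ∞) < {w | M.mem w x}.encard

/-- `M ⊨ nRC_fin`: every infinite set `x` has an infinite subset `y` with a function `f` from the
finite subsets of `y` with more than `n` elements to the `n`-element subsets of `y`, such that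
`f(z) ⊆ z` for all `z`. -/
def SatisfiesRCfin (n : ℕ) : Prop :=
  ∀ x, M.IsInfiniteSet x → ∃ y, M.Subset y x ∧ M.IsInfiniteSet y ∧
    ∃ f, M.IsFunctionOn f (fun z => M.Subset z y ∧ M.IsFiniteSetOfCardGT z n) ∧
      ∀ z v, M.Maps f z v → M.HasCard v n ∧ M.Subset v z

/-- `M ⊨ nC⁻_fin`: every infinite family `F` of finite sets with more than `n` elements has an
infinite subfamily `B` with a function `f` on `B` such that `f(z)` is an `n`-element subset of `z`
for all `z ∈ B`. -/
def SatisfiesCminusfin (n : ℕ) : Prop :=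
  ∀ F, M.IsInfiniteSet F → (∀ z, M.mem z F → M.IsFiniteSetOfCardGT z n) →
    ∃ B, M.Subset B F ∧ M.IsInfiniteSet B ∧
      ∃ f, M.IsFunctionOn f (fun z => M.mem z B) ∧
        ∀ z v, M.Maps f z v → M.HasCard v n ∧ M.Subset v z

end ZFAStructure

/-- The permutation model given by the set `A` of atoms, the group `G` of permutations of `A` and the
normal ideal of finite subsets of `A`: the hereditarily symmetric objects. -/
def permutationModel (A : Type) (G : Subgroup (Equiv.Perm A)) : ZFAStructure.{u + 1} where
  Dom := {x : ZFAUniverse.{u} A // ZFAUniverse.HereditarilySymmetric G x}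
  mem x y := ZFAUniverse.Mem x.1 y.1
  atom x := ZFAUniverse.IsAtom x.1

/-! ## The models `𝒱_{n₁, …, n_l}` -/

/-- The atoms: `l` lines of blocks; the blocks of the `k`-th line are indexed by `ℚ`, and the block
with index `q` of the `k`-th line is the cycle `{(k, q, j) : j ∈ ℤ/n_k}` of length `n_k`. -/
abbrev BlockAtom {l : ℕ} (n : Fin l → ℕ) : Type := Σ k : Fin l, ℚ × ZMod (n k)

/-- The permutations of the atoms that preserve each line, permute its blocks preserving their
order (by `σ k`), and preserve the cyclic structure of the blocks (the block with index `q` of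
line `k` is mapped onto its image block up to a rotation by `c k q`). -/
def blockGroup {l : ℕ} (n : Fin l → ℕ) : Subgroup (Equiv.Perm (BlockAtom n)) where
  carrier := {π | ∃ (σ : Fin l → (ℚ ≃o ℚ)) (c : ∀ k : Fin l, ℚ → ZMod (n k)),
    ∀ (k : Fin l) (q : ℚ) (j : ZMod (n k)), π ⟨k, q, j⟩ = ⟨k, σ k q, j + c k q⟩}
  one_mem' := ⟨fun _ => OrderIso.refl ℚ, fun _ _ => 0, fun k q j => by simp⟩
  mul_mem' := by
    rintro π ρ ⟨σ, c, h⟩ ⟨τ, d, h'⟩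
    refine ⟨fun k => (τ k).trans (σ k), fun k q => d k q + c k (τ k q), fun k q j => ?_⟩
    simp [h, h', add_assoc]
  inv_mem' := by
    rintro π ⟨σ, c, h⟩
    refine ⟨fun k => (σ k).symm, fun k q => -c k ((σ k).symm q), fun k q j => ?_⟩
    rw [Equiv.Perm.inv_eq_iff_eq, h]
    simp

/-- The permutation model `𝒱_{n₁, …, n_l}`, for positive `n₁, …, n_l`. -/
def blockModel {l : ℕ} (n : Fin l → ℕ) : ZFAStructure.{u + 1} :=
  permutationModel.{u} (BlockAtom n) (blockGroup n)

/-! Every object of the model is supported by a finite set `T` of blocks: it is fixed by the group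
`fixBlocks m T` of those elements of `G` that fix the blocks of `T` pointwise. Write m_k for the
length of the cycles on line k.

Necessity of m_k ∣ n. A choice function in the model has a finite support. Take a set z built from
whole blocks of line k, at least one of them outside this support. Rotating such a block by one step
fixes the function and z, hence also the chosen n-element subset v of z. If v is invariant under the
rotation of every block occurring in z, it is a union of whole cycles of length m_k, so m_k ∣ n. For
C⁻ the sets z are finitely many layered copies of a single block; for RC, z is a union of n + 1
blocks. As the primes are distinct, divisibility by all p_k^{a_k} is divisibility by the product.

Sufficiency. Let x be infinite with support `T`. If all elements of x are supported by `T`, keep x.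
Otherwise some x₀ ∈ x is not; adding the blocks of a support of x₀ one at a time yields `T'` ⊇ `T`
and one further block (k, q) such that x₀ is supported by `T'` with (k, q), but not by `T'`
(`exists_critical_block`). The orbit y of x₀ under `fixBlocks m T'` is infinite, since a finite
orbit would force support `T'` (`supportedBy_of_finite_orbit`).

The heart is `supportedBy_of_moved`: a permutation in `fixBlocks m T'` that fixes such an object
cannot move its critical block. Hence a subgroup H of `fixBlocks m T'` with a finite orbit on the
object only rotates that block, and the orbit is governed by a homomorphism from H to ℤ/m_k
(`card_orbit_dvd`). Its size divides p_k^{a_k}, so it is a power of p_k dividing n. A finite set z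
that is a subset of y (for RC) or an element of y (for C⁻) thus splits, under its stabilizer, into
orbits of such sizes, and a greedy choice of orbits gives an invariant n-element subset
(`exists_invariant_subset`). Choosing one on a representative of each orbit of sets z and
transporting it gives a function with support `T'` (`exists_choice_function`). -/

open scoped Pointwise

/-! ### Sets, pairs and natural numbers in the universe with atoms -/

namespace ZFAUniverse

variable {A : Type}

/-- The set of elements of an object. -/
def elts (x : ZFAUniverse.{u} A) : Set (ZFAUniverse.{u} A) := {w | Mem w x}

theorem mem_elts {w x : ZFAUniverse.{u} A} : w ∈ elts x ↔ Mem w x := Iff.rfl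

/-- The object with a given code. -/
def ofCode (x : PreZFA.{u} A) : ZFAUniverse.{u} A := Quotient.mk _ x

theorem exists_ofCode (x : ZFAUniverse.{u} A) : ∃ c, ofCode c = x := Quotient.exists_rep x

theorem ofCode_eq_iff {x y : PreZFA.{u} A} : ofCode x = ofCode y ↔ PreZFA.Equiv x y :=
  Quotient.eq (r := PreZFA.setoid A)

theorem mem_ofCode_mk {w : ZFAUniverse.{u} A} {ι : Type u} {f : ι → PreZFA.{u} A} :
    Mem w (ofCode (PreZFA.mk ι f)) ↔ ∃ i, w = ofCode (f i) := by
  obtain ⟨x, rfl⟩ := exists_ofCode w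
  exact exists_congr fun i => ofCode_eq_iff.symm

theorem not_mem_atom {w : ZFAUniverse.{u} A} {a : A} : ¬ Mem w (atom a) := by
  induction w using Quotient.inductionOn with
  | h x => exact id

theorem isAtom_iff {x : ZFAUniverse.{u} A} : IsAtom x ↔ ∃ a, x = atom a := by
  induction x using Quotient.inductionOn with
  | h x =>
    cases x with
    | atom a => exact ⟨fun _ => ⟨a, rfl⟩, fun _ => trivial⟩
    | mk ι f =>
      refine ⟨fun h => h.elim, ?_⟩
      rintro ⟨a, h⟩
      have : PreZFA.Equiv (PreZFA.mk ι f) (PreZFA.atom a) := Quotient.exact h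
      simp [PreZFA.Equiv] at this

theorem isAtom_atom (a : A) : IsAtom (atom a : ZFAUniverse.{u} A) := trivial

theorem atom_injective : Function.Injective (atom : A → ZFAUniverse.{u} A) := by
  intro a b h
  have : PreZFA.Equiv (PreZFA.atom a) (PreZFA.atom b) := Quotient.exact h
  simpa [PreZFA.Equiv] using this

theorem elts_atom (a : A) : elts (atom a : ZFAUniverse.{u} A) = ∅ :=
  Set.eq_empty_of_forall_notMem fun _ => not_mem_atom

theorem ext_of_not_isAtom {x y : ZFAUniverse.{u} A} (hx : ¬ IsAtom x) (hy : ¬ IsAtom y)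
    (h : elts x = elts y) : x = y := by
  obtain ⟨x, rfl⟩ := exists_ofCode x
  obtain ⟨y, rfl⟩ := exists_ofCode y
  cases x with
  | atom a => exact (hx trivial).elim
  | mk ι f =>
    cases y with
    | atom a => exact (hy trivial).elim
    | mk κ g =>
      rw [ofCode_eq_iff]
      simp only [PreZFA.Equiv]
      constructor
      · intro i
        obtain ⟨j, hj⟩ := mem_ofCode_mk.1 (h.subset (mem_ofCode_mk.2 ⟨i, rfl⟩))
        exact ⟨j, ofCode_eq_iff.1 hj⟩
      · intro i
        obtain ⟨j, hj⟩ := mem_ofCode_mk.1 (h.superset (mem_ofCode_mk.2 ⟨i, rfl⟩))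
        exact ⟨j, ofCode_eq_iff.1 hj.symm⟩

theorem small_elts (x : ZFAUniverse.{u} A) : Small.{u} (elts x) := by
  obtain ⟨x, rfl⟩ := exists_ofCode x
  cases x with
  | atom a =>
    change Small.{u} (elts (atom a))
    rw [elts_atom]
    infer_instance
  | mk ι f =>
    have : elts (ofCode (PreZFA.mk ι f)) = Set.range fun i => ofCode (f i) := by
      ext w
      rw [mem_elts, mem_ofCode_mk, Set.mem_range]
      exact exists_congr fun i => eq_comm
    rw [this]
    infer_instance

theorem exists_elts_eq (s : Set (ZFAUniverse.{u} A)) (hs : Small.{u} s) :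
    ∃ x : ZFAUniverse.{u} A, ¬ IsAtom x ∧ elts x = s := by
  choose c hc using exists_ofCode (A := A)
  refine ⟨ofCode (PreZFA.mk (Shrink.{u} s) fun i => c ((equivShrink s).symm i).1), id, ?_⟩
  ext w
  rw [mem_elts, mem_ofCode_mk]
  simp only [hc]
  constructor
  · rintro ⟨i, rfl⟩
    exact ((equivShrink s).symm i).2
  · intro hw
    exact ⟨equivShrink s ⟨w, hw⟩, by simp⟩

open Classical in
/-- The set with the elements `s`, for a small class `s`. -/
noncomputable def ofSet (s : Set (ZFAUniverse.{u} A)) : ZFAUniverse.{u} A :=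
  if hs : Small.{u} s then (exists_elts_eq s hs).choose
  else (exists_elts_eq ∅ inferInstance).choose

theorem not_isAtom_ofSet (s : Set (ZFAUniverse.{u} A)) : ¬ IsAtom (ofSet s) := by
  unfold ofSet
  split_ifs with h
  · exact (exists_elts_eq s h).choose_spec.1
  · exact (exists_elts_eq (A := A) ∅ inferInstance).choose_spec.1

theorem elts_ofSet {s : Set (ZFAUniverse.{u} A)} (hs : Small.{u} s) : elts (ofSet s) = s := by
  unfold ofSet
  rw [dif_pos hs]
  exact (exists_elts_eq s hs).choose_spec.2

theorem small_of_finite {s : Set (ZFAUniverse.{u} A)} (hs : s.Finite) : Small.{u} s := by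
  have := hs.countable.to_subtype
  infer_instance

theorem ofSet_elts {x : ZFAUniverse.{u} A} (hx : ¬ IsAtom x) : ofSet (elts x) = x :=
  ext_of_not_isAtom (not_isAtom_ofSet _) hx (elts_ofSet (small_elts x))

theorem smul_atom (π : Equiv.Perm A) (a : A) :
    π • (atom a : ZFAUniverse.{u} A) = atom (π a) := rfl

theorem isAtom_smul {π : Equiv.Perm A} {x : ZFAUniverse.{u} A} : IsAtom (π • x) ↔ IsAtom x := by
  simp only [isAtom_iff]
  constructor
  · rintro ⟨a, h⟩
    exact ⟨π⁻¹ a, by rw [← smul_atom, ← h, inv_smul_smul]⟩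
  · rintro ⟨a, rfl⟩
    exact ⟨π a, rfl⟩

theorem Mem.smul (π : Equiv.Perm A) {w x : ZFAUniverse.{u} A} (h : Mem w x) :
    Mem (π • w) (π • x) := by
  obtain ⟨x, rfl⟩ := exists_ofCode x
  cases x with
  | atom a => exact (not_mem_atom h).elim
  | mk ι f =>
    obtain ⟨i, rfl⟩ := mem_ofCode_mk.1 h
    exact mem_ofCode_mk.2 ⟨i, rfl⟩

theorem elts_smul (π : Equiv.Perm A) (x : ZFAUniverse.{u} A) : elts (π • x) = π • elts x := by
  ext w
  rw [Set.mem_smul_set_iff_inv_smul_mem]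
  constructor
  · intro h
    have := Mem.smul π⁻¹ h
    rwa [inv_smul_smul] at this
  · intro h
    have := Mem.smul π h
    rwa [smul_inv_smul] at this

theorem small_smul (π : Equiv.Perm A) {s : Set (ZFAUniverse.{u} A)} (hs : Small.{u} s) :
    Small.{u} (π • s : Set (ZFAUniverse.{u} A)) := by
  rw [← Set.image_smul]
  infer_instance

theorem smul_ofSet (π : Equiv.Perm A) {s : Set (ZFAUniverse.{u} A)} (hs : Small.{u} s) :
    π • ofSet s = ofSet (π • s) := by
  refine ext_of_not_isAtom (fun h => not_isAtom_ofSet s (isAtom_smul.1 h)) (not_isAtom_ofSet _) ?_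
  rw [elts_smul, elts_ofSet hs, elts_ofSet (small_smul π hs)]

/-- The unordered pair. -/
noncomputable def upair (x y : ZFAUniverse.{u} A) : ZFAUniverse.{u} A := ofSet {x, y}

theorem elts_upair (x y : ZFAUniverse.{u} A) : elts (upair x y) = {x, y} :=
  elts_ofSet (small_of_finite (by simp))

theorem smul_upair (π : Equiv.Perm A) (x y : ZFAUniverse.{u} A) :
    π • upair x y = upair (π • x) (π • y) := by
  rw [upair, smul_ofSet π (small_of_finite (by simp)), upair, Set.smul_set_insert,
    Set.smul_set_singleton]

/-- The ordered pair. -/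
noncomputable def opair (x y : ZFAUniverse.{u} A) : ZFAUniverse.{u} A :=
  upair (upair x x) (upair x y)

theorem smul_opair (π : Equiv.Perm A) (x y : ZFAUniverse.{u} A) :
    π • opair x y = opair (π • x) (π • y) := by
  simp only [opair, smul_upair]

theorem upair_eq_upair_iff {x y z w : ZFAUniverse.{u} A} :
    upair x y = upair z w ↔ (x = z ∧ y = w) ∨ (x = w ∧ y = z) := by
  constructor
  · intro h
    have := congrArg elts h
    rwa [elts_upair, elts_upair, Set.pair_eq_pair_iff] at this
  · rintro (⟨rfl, rfl⟩ | ⟨rfl, rfl⟩)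
    · rfl
    · rw [upair, upair, Set.pair_comm]

theorem opair_inj {x y z w : ZFAUniverse.{u} A} : opair x y = opair z w ↔ x = z ∧ y = w := by
  simp only [opair, upair_eq_upair_iff]
  constructor
  · rintro (⟨⟨h1, h2⟩ | ⟨h1, h2⟩, ⟨h3, h4⟩ | ⟨h3, h4⟩⟩ |
      ⟨⟨h1, h2⟩ | ⟨h1, h2⟩, ⟨h3, h4⟩ | ⟨h3, h4⟩⟩) <;> grind
  · rintro ⟨rfl, rfl⟩
    simp

/-- The finite von Neumann ordinals. -/
noncomputable def vonNeumann : ℕ → ZFAUniverse.{u} A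
  | 0 => ofSet ∅
  | n + 1 => ofSet (insert (vonNeumann n) (elts (vonNeumann n)))

theorem elts_vonNeumann_zero : elts (vonNeumann 0 : ZFAUniverse.{u} A) = ∅ :=
  elts_ofSet (small_of_finite Set.finite_empty)

theorem elts_vonNeumann_succ (n : ℕ) : elts (vonNeumann (n + 1) : ZFAUniverse.{u} A) =
    insert (vonNeumann n) (elts (vonNeumann n)) := by
  have := small_elts (vonNeumann n : ZFAUniverse.{u} A)
  exact elts_ofSet (small_insert _ _)

theorem not_isAtom_vonNeumann (n : ℕ) : ¬ IsAtom (vonNeumann n : ZFAUniverse.{u} A) := by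
  cases n <;> exact not_isAtom_ofSet _

theorem elts_vonNeumann (n : ℕ) :
    elts (vonNeumann n : ZFAUniverse.{u} A) = vonNeumann '' Set.Iio n := by
  induction n with
  | zero => simp [elts_vonNeumann_zero]
  | succ n ih => 
    rw [elts_vonNeumann_succ, ih, ← Set.image_insert_eq]
    congr 1
    ext i
    simp only [Set.mem_insert_iff, Set.mem_Iio]
    omega

/-- Were they equal, the ordinal of `i` would be an element of itself, hence equal to that of some
`k < i`; this descent replaces an appeal to foundation. -/
theorem vonNeumann_ne_of_lt (i : ℕ) :
    ∀ j, i < j → (vonNeumann i : ZFAUniverse.{u} A) ≠ vonNeumann j := by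
  induction i using Nat.strong_induction_on with
  | _ i ih =>
    intro j hij h
    have h1 : (vonNeumann i : ZFAUniverse.{u} A) ∈ elts (vonNeumann j) := by
      rw [elts_vonNeumann]
      exact ⟨i, hij, rfl⟩
    rw [← h, elts_vonNeumann] at h1
    obtain ⟨k, hk, hk'⟩ := h1
    exact ih k hk i hk hk'

theorem vonNeumann_injective :
    Function.Injective (vonNeumann : ℕ → ZFAUniverse.{u} A) := by
  intro i j h
  rcases lt_trichotomy i j with hij | hij | hij
  · exact (vonNeumann_ne_of_lt i j hij h).elim
  · exact hij
  · exact (vonNeumann_ne_of_lt j i hij h.symm).elim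

theorem smul_vonNeumann (π : Equiv.Perm A) (n : ℕ) :
    π • (vonNeumann n : ZFAUniverse.{u} A) = vonNeumann n := by
  induction n with
  | zero =>
    rw [vonNeumann, smul_ofSet π (small_of_finite Set.finite_empty), Set.smul_set_empty]
  | succ n ih =>
    have := small_elts (vonNeumann n : ZFAUniverse.{u} A)
    rw [vonNeumann, smul_ofSet π (small_insert _ _), Set.smul_set_insert, ← elts_smul, ih]

/-- The `i`-fold singleton of an atom. -/
noncomputable def nestedAtom (a : A) : ℕ → ZFAUniverse.{u} A
  | 0 => atom a
  | i + 1 => upair (nestedAtom a i) (nestedAtom a i)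

theorem smul_nestedAtom (π : Equiv.Perm A) (a : A) (i : ℕ) :
    π • (nestedAtom a i : ZFAUniverse.{u} A) = nestedAtom (π a) i := by
  induction i with
  | zero => rfl
  | succ i ih => rw [nestedAtom, smul_upair, ih, nestedAtom]

/-- The iterated singletons are disjoint equivariant copies of the set of atoms. They inflate a
block beyond any given size while keeping all cycles of the original length. -/
theorem nestedAtom_inj {a b : A} {i j : ℕ}
    (h : (nestedAtom a i : ZFAUniverse.{u} A) = nestedAtom b j) : a = b ∧ i = j := by
  induction i generalizing j with
  | zero =>
    cases j with
    | zero => exact ⟨atom_injective h, rfl⟩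
    | succ j => exact (not_isAtom_ofSet _ ((congrArg IsAtom h).mp (isAtom_atom a))).elim
  | succ i ih =>
    cases j with
    | zero => exact (not_isAtom_ofSet _ ((congrArg IsAtom h).mpr (isAtom_atom b))).elim
    | succ j =>
      rw [nestedAtom, nestedAtom, upair_eq_upair_iff] at h
      have := ih (j := j) (by tauto)
      exact ⟨this.1, by omega⟩

section Symmetric

variable {G : Subgroup (Equiv.Perm A)}

theorem hereditarilySymmetric_iff {x : ZFAUniverse.{u} A} :
    HereditarilySymmetric G x ↔ Symmetric G x ∧ ∀ y ∈ elts x, HereditarilySymmetric G y :=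
  ⟨fun h => by cases h with | intro _ h1 h2 => exact ⟨h1, h2⟩, fun h => .intro _ h.1 h.2⟩

theorem HereditarilySymmetric.of_mem {x y : ZFAUniverse.{u} A}
    (hx : HereditarilySymmetric G x) (h : y ∈ elts x) : HereditarilySymmetric G y :=
  (hereditarilySymmetric_iff.1 hx).2 y h

theorem hereditarilySymmetric_of_fixed {x : ZFAUniverse.{u} A} (h : ∀ π ∈ G, π • x = x)
    (h' : ∀ y ∈ elts x, HereditarilySymmetric G y) : HereditarilySymmetric G x :=
  hereditarilySymmetric_iff.2 ⟨⟨∅, Set.finite_empty, fun g _ => h g.1 g.2⟩, h'⟩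

theorem hereditarilySymmetric_atom (a : A) :
    HereditarilySymmetric G (atom a : ZFAUniverse.{u} A) := by
  refine hereditarilySymmetric_iff.2 ⟨⟨{a}, Set.finite_singleton a, fun g hg => ?_⟩, ?_⟩
  · exact congrArg atom (hg (Set.mem_singleton a))
  · simp [elts_atom]

theorem hereditarilySymmetric_ofSet {s : Set (ZFAUniverse.{u} A)} (hs : s.Finite)
    (h : ∀ y ∈ s, HereditarilySymmetric G y) : HereditarilySymmetric G (ofSet s) := by
  rw [hereditarilySymmetric_iff, elts_ofSet (small_of_finite hs)]
  refine ⟨?_, h⟩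
  have : ∀ y ∈ s, ∃ E : Set A, E.Finite ∧ MulAction.Supports G E y :=
    fun y hy => (hereditarilySymmetric_iff.1 (h y hy)).1
  choose! E hE hE' using this
  refine ⟨⋃ y ∈ s, E y, hs.biUnion hE, fun g hg => ?_⟩
  change g.1 • ofSet s = ofSet s
  rw [smul_ofSet _ (small_of_finite hs), ← Set.image_smul]
  congr 1
  have : ∀ y ∈ s, g.1 • y = y := fun y hy =>
    hE' y hy g fun a ha => hg (Set.mem_biUnion hy ha)
  rw [Set.image_congr this, Set.image_id']

theorem hereditarilySymmetric_upair {x y : ZFAUniverse.{u} A} (hx : HereditarilySymmetric G x)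
    (hy : HereditarilySymmetric G y) : HereditarilySymmetric G (upair x y) :=
  hereditarilySymmetric_ofSet (by simp) (by simp [hx, hy])

theorem hereditarilySymmetric_opair {x y : ZFAUniverse.{u} A} (hx : HereditarilySymmetric G x)
    (hy : HereditarilySymmetric G y) : HereditarilySymmetric G (opair x y) :=
  hereditarilySymmetric_upair (hereditarilySymmetric_upair hx hx)
    (hereditarilySymmetric_upair hx hy)

theorem hereditarilySymmetric_vonNeumann (n : ℕ) :
    HereditarilySymmetric G (vonNeumann n : ZFAUniverse.{u} A) := by
  induction n using Nat.strong_induction_on with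
  | _ n ih =>
    refine hereditarilySymmetric_of_fixed (fun π _ => smul_vonNeumann π n) ?_
    rw [elts_vonNeumann]
    rintro _ ⟨i, hi, rfl⟩
    exact ih i hi

theorem hereditarilySymmetric_nestedAtom (a : A) (i : ℕ) :
    HereditarilySymmetric G (nestedAtom a i : ZFAUniverse.{u} A) := by
  induction i with
  | zero => exact hereditarilySymmetric_atom a
  | succ i ih => exact hereditarilySymmetric_upair ih ih

end Symmetric

end ZFAUniverse

/-! ### Order automorphisms of ℚ -/

section OrderIso

/-- The piecewise linear map that is the identity outside `(u, v)` and maps `q` to `q'`. -/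
def stretch (u v q q' x : ℚ) : ℚ :=
  if x ≤ u then x else if x ≤ q then u + (x - u) * ((q' - u) / (q - u))
  else if x < v then v - (v - x) * ((v - q') / (v - q)) else x

theorem stretch_of_le {u v q q' x : ℚ} (h : x ≤ u) : stretch u v q q' x = x := if_pos h

theorem stretch_of_ge {u v q q' x : ℚ} (hqv : q < v) (h : v ≤ x) : stretch u v q q' x = x := by
  unfold stretch
  rw [if_neg (c := x ≤ q) (by linarith), if_neg (c := x < v) (by linarith), ite_self]

theorem stretch_of_mem_Ioc {u v q q' x : ℚ} (h : u < x) (h' : x ≤ q) :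
    stretch u v q q' x = u + (x - u) * ((q' - u) / (q - u)) := by
  rw [stretch, if_neg h.not_ge, if_pos h']

theorem stretch_of_mem_Ioo {u v q q' x : ℚ} (huq : u < q) (h : q < x) (h' : x < v) :
    stretch u v q q' x = v - (v - x) * ((v - q') / (v - q)) := by
  rw [stretch, if_neg (huq.trans h).not_ge, if_neg h.not_ge, if_pos h']

variable {u v q q' : ℚ}

theorem stretch_mem_Ioc (hu' : u < q') {x : ℚ} (h : u < x) (h' : x ≤ q) :
    u < stretch u v q q' x ∧ stretch u v q q' x ≤ q' := by
  rw [stretch_of_mem_Ioc h h']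
  have h1 : 0 < q - u := by linarith
  have h2 : 0 < q' - u := by linarith
  have h3 : 0 < x - u := by linarith
  constructor
  · have : 0 < (x - u) * ((q' - u) / (q - u)) := by positivity
    linarith
  · have : (x - u) * ((q' - u) / (q - u)) ≤ (q - u) * ((q' - u) / (q - u)) := by gcongr
    rw [mul_div_cancel₀ _ h1.ne'] at this
    linarith

theorem stretch_mem_Ioo (hu : u < q) (hv' : q' < v) {x : ℚ} (h : q < x) (h' : x < v) :
    q' < stretch u v q q' x ∧ stretch u v q q' x < v := by
  rw [stretch_of_mem_Ioo hu h h']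
  have h1 : 0 < v - q := by linarith
  have h2 : 0 < v - q' := by linarith
  have h3 : 0 < v - x := by linarith
  constructor
  · have : (v - x) * ((v - q') / (v - q)) < (v - q) * ((v - q') / (v - q)) := by gcongr
    rw [mul_div_cancel₀ _ h1.ne'] at this
    linarith
  · have : 0 < (v - x) * ((v - q') / (v - q)) := by positivity
    linarith

theorem stretch_strictMono (hu : u < q) (hv : q < v) (hu' : u < q') (hv' : q' < v) :
    StrictMono (stretch u v q q') := by
  intro x y hxy
  rcases le_or_gt x u with hx | hx
  · rw [stretch_of_le hx]
    rcases le_or_gt y u with hy | hy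
    · rwa [stretch_of_le hy]
    rcases le_or_gt y q with hy' | hy'
    · exact hx.trans_lt (stretch_mem_Ioc hu' hy hy').1
    rcases lt_or_ge y v with hy'' | hy''
    · exact hx.trans_lt (hu'.trans (stretch_mem_Ioo hu hv' hy' hy'').1)
    · rwa [stretch_of_ge hv hy'']
  rcases le_or_gt x q with hx' | hx'
  · rcases le_or_gt y q with hy' | hy'
    · rw [stretch_of_mem_Ioc hx hx', stretch_of_mem_Ioc (hx.trans hxy) hy']
      have h1 : 0 < q - u := by linarith
      have h2 : 0 < q' - u := by linarith
      gcongr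
    rcases lt_or_ge y v with hy'' | hy''
    · exact (stretch_mem_Ioc hu' hx hx').2.trans_lt (stretch_mem_Ioo hu hv' hy' hy'').1
    · rw [stretch_of_ge hv hy'']
      exact (stretch_mem_Ioc hu' hx hx').2.trans_lt (hv'.trans_le hy'')
  rcases lt_or_ge x v with hx'' | hx''
  · rcases lt_or_ge y v with hy'' | hy''
    · rw [stretch_of_mem_Ioo hu hx' hx'', stretch_of_mem_Ioo hu (hx'.trans hxy) hy'']
      have h1 : 0 < v - q := by linarith
      have h2 : 0 < v - q' := by linarith
      gcongr
    · rw [stretch_of_ge hv hy'']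
      exact (stretch_mem_Ioo hu hv' hx' hx'').2.trans_le hy''
  · rwa [stretch_of_ge hv hx'', stretch_of_ge hv (hx''.trans hxy.le)]

theorem stretch_stretch (hu : u < q) (hv : q < v) (hu' : u < q') (hv' : q' < v) (x : ℚ) :
    stretch u v q q' (stretch u v q' q x) = x := by
  have h1 : q - u ≠ 0 := by linarith
  have h2 : q' - u ≠ 0 := by linarith
  have h3 : v - q ≠ 0 := by linarith
  have h4 : v - q' ≠ 0 := by linarith
  rcases le_or_gt x u with hx | hx
  · rw [stretch_of_le (x := x) hx, stretch_of_le hx]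
  rcases le_or_gt x q' with hx' | hx'
  · have := stretch_mem_Ioc (v := v) hu hx hx'
    rw [stretch_of_mem_Ioc this.1 this.2, stretch_of_mem_Ioc hx hx']
    field_simp
    ring
  rcases lt_or_ge x v with hx'' | hx''
  · have := stretch_mem_Ioo hu' hv hx' hx''
    rw [stretch_of_mem_Ioo hu this.1 this.2, stretch_of_mem_Ioo hu' hx' hx'']
    field_simp
    ring
  · rw [stretch_of_ge (x := x) hv' hx'', stretch_of_ge hv hx'']

theorem exists_lt_forall_le (T : Finset ℚ) (r : ℚ) : ∃ u < r, ∀ t ∈ T, t < r → t ≤ u := by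
  induction T using Finset.induction_on with
  | empty => exact ⟨r - 1, by linarith, by simp⟩
  | insert a s _ ih =>
    obtain ⟨u, hu, h⟩ := ih
    by_cases ha : a < r
    · refine ⟨max u a, max_lt hu ha, ?_⟩
      simp only [Finset.mem_insert, forall_eq_or_imp]
      exact ⟨fun _ => le_max_right _ _, fun t ht htr => (h t ht htr).trans (le_max_left _ _)⟩
    · refine ⟨u, hu, ?_⟩
      simp only [Finset.mem_insert, forall_eq_or_imp]
      exact ⟨fun h' => (ha h').elim, h⟩

theorem exists_gt_forall_ge (T : Finset ℚ) (r : ℚ) : ∃ u > r, ∀ t ∈ T, r < t → u ≤ t := by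
  induction T using Finset.induction_on with
  | empty => exact ⟨r + 1, by linarith, by simp⟩
  | insert a s _ ih =>
    obtain ⟨u, hu, h⟩ := ih
    by_cases ha : r < a
    · refine ⟨min u a, lt_min hu ha, ?_⟩
      simp only [Finset.mem_insert, forall_eq_or_imp]
      exact ⟨fun _ => min_le_right _ _, fun t ht htr => (min_le_left _ _).trans (h t ht htr)⟩
    · refine ⟨u, hu, ?_⟩
      simp only [Finset.mem_insert, forall_eq_or_imp]
      exact ⟨fun h' => (ha h').elim, h⟩

/-- The order automorphisms of `ℚ` that fix a finite set act transitively on each of the open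
intervals it leaves. -/
theorem exists_orderIso_rat (T : Finset ℚ) {q q' : ℚ} (hq : q ∉ T) (hq' : q' ∉ T)
    (h : ∀ t ∈ T, t < q ↔ t < q') : ∃ σ : ℚ ≃o ℚ, σ q = q' ∧ ∀ t ∈ T, σ t = t := by
  -- No point of `T` lies between `q` and `q'`, so `(u, v)` contains both and misses `T`; stretching
  -- inside it fixes `T`. The inverse stretch has `q` and `q'` interchanged.
  obtain ⟨u, hu, hu'⟩ := exists_lt_forall_le T (min q q')
  obtain ⟨v, hv, hv'⟩ := exists_gt_forall_ge T (max q q')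
  obtain ⟨h1, h2⟩ := lt_min_iff.1 hu
  obtain ⟨h3, h4⟩ := max_lt_iff.1 hv
  refine ⟨(stretch_strictMono h1 h3 h2 h4).orderIsoOfRightInverse _ (stretch u v q' q)
    (stretch_stretch h1 h3 h2 h4), ?_, fun t ht => ?_⟩
  · change stretch u v q q' q = q'
    rw [stretch_of_mem_Ioc h1 le_rfl, mul_div_cancel₀ _ (by linarith)]
    ring
  · change stretch u v q q' t = t
    rcases lt_trichotomy t q with htq | rfl | htq
    · exact stretch_of_le (hu' t ht (lt_min htq ((h t ht).1 htq)))
    · exact (hq ht).elim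
    · refine stretch_of_ge h3 (hv' t ht (max_lt htq (lt_of_le_of_ne ?_ ?_)))
      · exact not_lt.1 fun h' => htq.not_gt ((h t ht).2 h')
      · rintro rfl
        exact hq' ht

end OrderIso

/-! ### Permutations of the blocks -/

section BlockPermutations

variable {l : ℕ} {m : Fin l → ℕ}

/-- The permutation of the atoms given by its action on the blocks and its rotations. -/
def blockPerm (σ : Fin l → (ℚ ≃o ℚ)) (c : ∀ k : Fin l, ℚ → ZMod (m k)) :
    Equiv.Perm (BlockAtom m) where
  toFun x := ⟨x.1, σ x.1 x.2.1, x.2.2 + c x.1 x.2.1⟩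
  invFun x := ⟨x.1, (σ x.1).symm x.2.1, x.2.2 - c x.1 ((σ x.1).symm x.2.1)⟩
  left_inv := by rintro ⟨k, q, j⟩; simp
  right_inv := by rintro ⟨k, q, j⟩; simp

theorem blockPerm_apply (σ : Fin l → (ℚ ≃o ℚ)) (c : ∀ k : Fin l, ℚ → ZMod (m k)) (k : Fin l)
    (q : ℚ) (j : ZMod (m k)) :
    (blockPerm σ c : Equiv.Perm (BlockAtom m)) ⟨k, q, j⟩ = ⟨k, σ k q, j + c k q⟩ := rfl

theorem blockPerm_mem (σ : Fin l → (ℚ ≃o ℚ)) (c : ∀ k : Fin l, ℚ → ZMod (m k)) :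
    blockPerm σ c ∈ blockGroup m := ⟨σ, c, fun _ _ _ => rfl⟩

/-- The elements of the group that fix all atoms of the blocks with indices in `T`. -/
def fixBlocks (m : Fin l → ℕ) (T : Finset (Fin l × ℚ)) : Subgroup (Equiv.Perm (BlockAtom m)) where
  carrier := {π | π ∈ blockGroup m ∧ ∀ k q, (k, q) ∈ T → ∀ j, π ⟨k, q, j⟩ = ⟨k, q, j⟩}
  one_mem' := ⟨one_mem _, fun _ _ _ _ => rfl⟩
  mul_mem' := by
    rintro π ρ ⟨h1, h2⟩ ⟨h3, h4⟩
    refine ⟨mul_mem h1 h3, fun k q h j => ?_⟩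
    rw [Equiv.Perm.mul_apply, h4 k q h, h2 k q h]
  inv_mem' := by
    rintro π ⟨h1, h2⟩
    refine ⟨inv_mem h1, fun k q h j => ?_⟩
    rw [Equiv.Perm.inv_eq_iff_eq, h2 k q h]

theorem fixBlocks_anti {S T : Finset (Fin l × ℚ)} (h : S ⊆ T) : fixBlocks m T ≤ fixBlocks m S :=
  fun _ hπ => ⟨hπ.1, fun k q hk => hπ.2 k q (h hk)⟩

/-- `π` maps the block `q` of line `k` to the block `q'` by a cyclic isomorphism. -/
def MapsBlock (π : Equiv.Perm (BlockAtom m)) (k : Fin l) (q q' : ℚ) : Prop :=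
  ∃ e : ZMod (m k), ∀ j, π ⟨k, q, j⟩ = ⟨k, q', j + e⟩

theorem exists_mapsBlock {π : Equiv.Perm (BlockAtom m)} (hπ : π ∈ blockGroup m) (k : Fin l) :
    ∃ σ : ℚ ≃o ℚ, ∀ q, MapsBlock π k q (σ q) := by
  obtain ⟨σ, c, h⟩ := hπ
  exact ⟨σ k, fun q => ⟨c k q, h k q⟩⟩

theorem MapsBlock.unique {π : Equiv.Perm (BlockAtom m)} {k : Fin l} {q q' q'' : ℚ}
    (h : MapsBlock π k q q') (h' : MapsBlock π k q q'') : q' = q'' := by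
  obtain ⟨e, he⟩ := h
  obtain ⟨e', he'⟩ := h'
  have := (he 0).symm.trans (he' 0)
  simp only [Sigma.mk.injEq, heq_eq_eq, Prod.mk.injEq, true_and] at this
  exact this.1

theorem MapsBlock.mul {π ρ : Equiv.Perm (BlockAtom m)} {k : Fin l} {q q' q'' : ℚ}
    (h : MapsBlock π k q q') (h' : MapsBlock ρ k q' q'') : MapsBlock (ρ * π) k q q'' := by
  obtain ⟨e, he⟩ := h
  obtain ⟨e', he'⟩ := h'
  exact ⟨e + e', fun j => by rw [Equiv.Perm.mul_apply, he, he', add_assoc]⟩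

theorem MapsBlock.inv {π : Equiv.Perm (BlockAtom m)} {k : Fin l} {q q' : ℚ}
    (h : MapsBlock π k q q') : MapsBlock π⁻¹ k q' q := by
  obtain ⟨e, he⟩ := h
  exact ⟨-e, fun j => by rw [Equiv.Perm.inv_eq_iff_eq, he]; simp⟩

theorem mapsBlock_of_mem {T : Finset (Fin l × ℚ)} {π : Equiv.Perm (BlockAtom m)}
    (hπ : π ∈ fixBlocks m T) {k : Fin l} {q : ℚ} (h : (k, q) ∈ T) : MapsBlock π k q q :=
  ⟨0, fun j => by rw [hπ.2 k q h, add_zero]⟩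

/-- The rotation of one block by `e`. -/
def blockRotation (k : Fin l) (q : ℚ) (e : ZMod (m k)) : Equiv.Perm (BlockAtom m) :=
  blockPerm (fun _ => OrderIso.refl ℚ) (Pi.single k (Pi.single q e))

theorem blockRotation_apply (k : Fin l) (q : ℚ) (e j : ZMod (m k)) :
    blockRotation k q e ⟨k, q, j⟩ = (⟨k, q, j + e⟩ : BlockAtom m) := by
  simp [blockRotation, blockPerm_apply]

theorem blockRotation_apply_of_ne {k k' : Fin l} {q q' : ℚ} (e : ZMod (m k)) (h : (k', q') ≠ (k, q))
    (j : ZMod (m k')) : blockRotation k q e ⟨k', q', j⟩ = (⟨k', q', j⟩ : BlockAtom m) := by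
  rw [blockRotation, blockPerm_apply]
  by_cases hk : k' = k
  · subst hk
    have : q' ≠ q := fun hq => h (by rw [hq])
    simp [this]
  · simp [hk]

theorem blockRotation_mem_fixBlocks {T : Finset (Fin l × ℚ)} {k : Fin l} {q : ℚ} (h : (k, q) ∉ T)
    (e : ZMod (m k)) : blockRotation k q e ∈ fixBlocks m T :=
  ⟨blockPerm_mem _ _, fun _ _ hk j =>
    blockRotation_apply_of_ne e (fun h' => h (h' ▸ hk)) j⟩

/-- Move line `k` alone, by an automorphism of ℚ fixing the indices of `T` on that line, with no
rotation. -/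
theorem exists_mapsBlock_of_gap {T : Finset (Fin l × ℚ)} {k : Fin l} {q q' : ℚ}
    (hq : (k, q) ∉ T) (hq' : (k, q') ∉ T) (h : ∀ t, (k, t) ∈ T → (t < q ↔ t < q')) :
    ∃ π ∈ fixBlocks m T, MapsBlock π k q q' := by
  classical
  obtain ⟨S, hS⟩ : ∃ S : Finset ℚ, ∀ t, t ∈ S ↔ (k, t) ∈ T := by
    refine ⟨(T.filter fun b => b.1 = k).image Prod.snd, fun t => ?_⟩
    simp only [Finset.mem_image, Finset.mem_filter]
    constructor
    · rintro ⟨⟨k', t'⟩, ⟨h1, rfl⟩, rfl⟩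
      exact h1
    · intro ht
      exact ⟨(k, t), ⟨ht, rfl⟩, rfl⟩
  obtain ⟨σ, h1, h2⟩ := exists_orderIso_rat S (fun h' => hq ((hS q).1 h'))
    (fun h' => hq' ((hS q').1 h')) (fun t ht => h t ((hS t).1 ht))
  refine ⟨blockPerm (Function.update (fun _ => OrderIso.refl ℚ) k σ) 0,
    ⟨blockPerm_mem _ _, fun k' t ht j => ?_⟩, 0, fun j => ?_⟩
  · rw [blockPerm_apply]
    by_cases hk : k' = k
    · subst hk
      simp [h2 t ((hS t).2 ht)]
    · simp [hk]
  · rw [blockPerm_apply]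
    simp [h1]

theorem lt_iff_lt_of_mapsBlock {T : Finset (Fin l × ℚ)} {π : Equiv.Perm (BlockAtom m)}
    (hπ : π ∈ fixBlocks m T) {k : Fin l} {q q' t : ℚ} (h : MapsBlock π k q q')
    (ht : (k, t) ∈ T) : t < q ↔ t < q' := by
  obtain ⟨σ, hσ⟩ := exists_mapsBlock hπ.1 k
  rw [h.unique (hσ q), ← σ.lt_iff_lt, (hσ t).unique (mapsBlock_of_mem hπ ht)]

theorem notMem_of_mapsBlock {T : Finset (Fin l × ℚ)} {π : Equiv.Perm (BlockAtom m)}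
    (hπ : π ∈ fixBlocks m T) {k : Fin l} {q q' : ℚ} (h : MapsBlock π k q q')
    (hq : (k, q) ∉ T) : (k, q') ∉ T := by
  intro hq'
  exact hq (by rwa [h.inv.unique (mapsBlock_of_mem (inv_mem hπ) hq')])

end BlockPermutations

/-! ### Supports by blocks and sizes of finite orbits -/

section Supports

variable {l : ℕ} {m : Fin l → ℕ} {X : Type*} [MulAction (Equiv.Perm (BlockAtom m)) X]

/-- `w` is fixed by all elements of the group that fix the blocks with indices in `T`. -/
def SupportedBy (T : Finset (Fin l × ℚ)) (w : X) : Prop := ∀ π ∈ fixBlocks m T, π • w = w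

theorem SupportedBy.mono {S T : Finset (Fin l × ℚ)} {w : X} (h : SupportedBy (m := m) S w)
    (hST : S ⊆ T) : SupportedBy (m := m) T w :=
  fun π hπ => h π (fixBlocks_anti hST hπ)

theorem SupportedBy.smul_of_mem {T : Finset (Fin l × ℚ)} {w : X} {ρ : Equiv.Perm (BlockAtom m)}
    (h : SupportedBy (m := m) T (ρ • w)) (hρ : ρ ∈ fixBlocks m T) :
    SupportedBy (m := m) T w := by
  intro π hπ
  have := h (ρ * π * ρ⁻¹) (mul_mem (mul_mem hρ hπ) (inv_mem hρ))
  rw [← mul_smul, inv_mul_cancel_right, mul_smul] at this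
  exact smul_left_cancel ρ this

theorem SupportedBy.translate {T : Finset (Fin l × ℚ)} {k : Fin l} {q q' : ℚ} {w : X}
    (h : SupportedBy (m := m) (insert (k, q) T) w) {ρ : Equiv.Perm (BlockAtom m)}
    (hρ : ρ ∈ fixBlocks m T) (hq : MapsBlock ρ k q q') :
    SupportedBy (m := m) (insert (k, q') T) (ρ • w) := by
  intro π hπ
  have hπ' := fixBlocks_anti (Finset.subset_insert _ _) hπ
  have : ρ⁻¹ * π * ρ ∈ fixBlocks m (insert (k, q) T) := by
    refine ⟨mul_mem (mul_mem (inv_mem hρ.1) hπ.1) hρ.1, fun k' q'' hk j => ?_⟩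
    rcases Finset.mem_insert.1 hk with hk | hk
    · obtain ⟨rfl, rfl⟩ := Prod.mk.inj hk
      obtain ⟨e, he⟩ := hq
      rw [Equiv.Perm.mul_apply, Equiv.Perm.mul_apply, he,
        hπ.2 _ _ (Finset.mem_insert_self _ _), Equiv.Perm.inv_eq_iff_eq, he]
    · exact (mul_mem (mul_mem (inv_mem hρ) hπ') hρ).2 k' q'' hk j
  have := h _ this
  rw [mul_smul, mul_smul, inv_smul_eq_iff] at this
  exact this

/-- Since `ρ` fixes `w`, both `T` with `q` and `T` with `q'` support `w`. Any `g` fixing the blocks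
of `T` then factors into permutations each of which fixes `w`: one carrying `q` to its image under
`g`, a rotation of the block `q`, and one fixing that block pointwise. -/
theorem supportedBy_of_moved_up {T : Finset (Fin l × ℚ)} {k : Fin l} {q q' : ℚ} {w : X}
    (hw : SupportedBy (m := m) (insert (k, q) T) w) (hq : (k, q) ∉ T)
    {ρ : Equiv.Perm (BlockAtom m)} (hρ : ρ ∈ fixBlocks m T) (hρq : MapsBlock ρ k q q')
    (hlt : q < q') (hρw : ρ • w = w) : SupportedBy (m := m) T w := by
  have hw' : SupportedBy (m := m) (insert (k, q') T) w := hρw ▸ hw.translate hρ hρq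
  have hq' := notMem_of_mapsBlock hρ hρq hq
  intro g hg
  obtain ⟨σ, hσ⟩ := exists_mapsBlock hg.1 k
  have hc := notMem_of_mapsBlock hg (hσ q) hq
  have hgap : ∀ t, (k, t) ∈ T → (t < q ↔ t < σ q) :=
    fun t => lt_iff_lt_of_mapsBlock hg (hσ q)
  have hgap' : ∀ t, (k, t) ∈ T → (t < q ↔ t < q') :=
    fun t => lt_iff_lt_of_mapsBlock hρ hρq
  -- If `σ q` lies above `q`, go from `q` to `q'` by `ρ` and then to `σ q` while fixing the block
  -- `q`; otherwise `σ q` is below `q'`, and `q` can be moved to it while fixing the block `q'`.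
  obtain ⟨h, hh, hhw, hhq⟩ : ∃ h ∈ fixBlocks m T, h • w = w ∧ MapsBlock h k q (σ q) := by
    rcases lt_or_ge q (σ q) with hlt' | hle
    · obtain ⟨h, hh, hhq⟩ := exists_mapsBlock_of_gap (m := m) (T := insert (k, q) T) (k := k)
        (q := q') (q' := σ q) (by simp [hq', hlt.ne']) (by simp [hc, hlt'.ne']) (by
          intro t ht
          rcases Finset.mem_insert.1 ht with ht | ht
          · obtain ⟨-, rfl⟩ := Prod.mk.inj ht
            exact iff_of_true hlt hlt'
          · rw [← hgap t ht, ← hgap' t ht])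
      refine ⟨h * ρ, mul_mem (fixBlocks_anti (Finset.subset_insert _ _) hh) hρ, ?_, hρq.mul hhq⟩
      rw [mul_smul, hρw, hw h hh]
    · have hlt' := hle.trans_lt hlt
      obtain ⟨h, hh, hhq⟩ := exists_mapsBlock_of_gap (m := m) (T := insert (k, q') T) (k := k)
        (q := q) (q' := σ q) (by simp [hq, hlt.ne]) (by simp [hc, hlt'.ne]) (by
          intro t ht
          rcases Finset.mem_insert.1 ht with ht | ht
          · obtain ⟨-, rfl⟩ := Prod.mk.inj ht
            exact iff_of_false hlt.not_gt hlt'.not_gt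
          · exact hgap t ht)
      exact ⟨h, fixBlocks_anti (Finset.subset_insert _ _) hh, hw' h hh, hhq⟩
  -- `h⁻¹ * g` rotates the block `q` by `e`. That rotation alone fixes `w` because it leaves `T` and
  -- `q'` untouched; the remaining factor fixes `T` and `q`.
  obtain ⟨e, he⟩ := (hσ q).mul hhq.inv
  have hr : blockRotation k q e ∈ fixBlocks m (insert (k, q') T) :=
    blockRotation_mem_fixBlocks (by simp [hq, hlt.ne]) e
  have hs : (blockRotation k q e)⁻¹ * (h⁻¹ * g) ∈ fixBlocks m (insert (k, q) T) := by
    have hT : (blockRotation k q e)⁻¹ * (h⁻¹ * g) ∈ fixBlocks m T :=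
      mul_mem (inv_mem (fixBlocks_anti (Finset.subset_insert _ _) hr)) (mul_mem (inv_mem hh) hg)
    refine ⟨hT.1, fun k' q'' hk j => ?_⟩
    rcases Finset.mem_insert.1 hk with hk | hk
    · obtain ⟨rfl, rfl⟩ := Prod.mk.inj hk
      rw [Equiv.Perm.mul_apply, he, Equiv.Perm.inv_eq_iff_eq, blockRotation_apply]
    · exact hT.2 k' q'' hk j
  have := hw _ hs
  rw [mul_smul, inv_smul_eq_iff, hw' _ hr, mul_smul, inv_smul_eq_iff, hhw] at this
  exact this

theorem supportedBy_of_moved {T : Finset (Fin l × ℚ)} {k : Fin l} {q q' : ℚ} {w : X}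
    (hw : SupportedBy (m := m) (insert (k, q) T) w) (hq : (k, q) ∉ T)
    {ρ : Equiv.Perm (BlockAtom m)} (hρ : ρ ∈ fixBlocks m T) (hρq : MapsBlock ρ k q q')
    (hne : q ≠ q') (hρw : ρ • w = w) : SupportedBy (m := m) T w := by
  rcases hne.lt_or_gt with h | h
  · exact supportedBy_of_moved_up hw hq hρ hρq h hρw
  · have hw' : SupportedBy (m := m) (insert (k, q') T) w := hρw ▸ hw.translate hρ hρq
    exact supportedBy_of_moved_up hw' (notMem_of_mapsBlock hρ hρq hq) (inv_mem hρ) hρq.inv h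
      (by rw [inv_smul_eq_iff, hρw])

/-- By finiteness some power `h ^ d` with `d > 0` fixes `w`. An order automorphism has no periodic
points other than fixed points, so if `h` moved `q`, `h ^ d` would too, and `T` would support `w` by
`supportedBy_of_moved`. -/
theorem mapsBlock_self_of_finite {T : Finset (Fin l × ℚ)} {k : Fin l} {q : ℚ} {w : X}
    (hw : SupportedBy (m := m) (insert (k, q) T) w) (hnw : ¬ SupportedBy (m := m) T w)
    {h : Equiv.Perm (BlockAtom m)} (hh : h ∈ fixBlocks m T)
    (hfin : (Set.range fun i : ℕ => h ^ i • w).Finite) : MapsBlock h k q q := by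
  have hq : (k, q) ∉ T := fun hq => hnw (by rwa [Finset.insert_eq_of_mem hq] at hw)
  obtain ⟨i, j, hij, hw'⟩ : ∃ i j : ℕ, i < j ∧ h ^ i • w = h ^ j • w := by
    by_contra! hne
    refine Set.infinite_range_of_injective (fun i j hij => ?_) hfin
    rcases lt_trichotomy i j with h1 | h1 | h1
    · exact (hne i j h1 hij).elim
    · exact h1
    · exact (hne j i h1 hij.symm).elim
  obtain ⟨d, hd, rfl⟩ : ∃ d, 0 < d ∧ j = i + d := ⟨j - i, by omega, by omega⟩
  rw [pow_add, mul_smul] at hw'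
  have hd' : h ^ d • w = w := (smul_left_cancel _ hw').symm
  obtain ⟨σ, hσ⟩ := exists_mapsBlock hh.1 k
  have hpow : ∀ a : ℕ, MapsBlock (h ^ a) k q (σ^[a] q) := by
    intro a
    induction a with
    | zero => exact ⟨0, fun j => by simp⟩
    | succ a ih =>
      rw [pow_succ', Function.iterate_succ_apply']
      exact ih.mul (hσ _)
  by_cases hq' : σ q = q
  · have := hσ q
    rwa [hq'] at this
  · refine (hnw (supportedBy_of_moved hw hq (pow_mem hh d) (hpow d) ?_ hd')).elim
    rcases lt_or_gt_of_ne hq' with h1 | h1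
    · exact (σ.strictMono.strictAnti_iterate_of_map_lt h1 hd).ne'
    · exact (σ.strictMono.strictMono_iterate_of_lt_map h1 hd).ne

theorem exists_mapsBlock_ne {T : Finset (Fin l × ℚ)} {k : Fin l} {q : ℚ} (hq : (k, q) ∉ T) :
    ∃ π ∈ fixBlocks m T, ∃ q' ≠ q, MapsBlock π k q q' := by
  obtain ⟨v, hv, hv'⟩ := exists_gt_forall_ge (T.image Prod.snd) q
  have h : ∀ t, (k, t) ∈ T → q < t → v ≤ t := fun t ht =>
    hv' t (Finset.mem_image_of_mem Prod.snd ht)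
  obtain ⟨q', h1, h2⟩ := exists_between hv
  obtain ⟨π, hπ, hπ'⟩ := exists_mapsBlock_of_gap (m := m) hq (q' := q')
    (fun h' => (h q' h' h1).not_gt h2) (fun t ht => by
      constructor
      · exact fun h' => h'.trans h1
      · intro h'
        by_contra! hle
        have hne : q ≠ t := by
          rintro rfl
          exact hq ht
        exact ((h t ht (lt_of_le_of_ne hle hne)).trans_lt (h'.trans h2)).false)
  exact ⟨π, hπ, q', h1.ne', hπ'⟩

/-- Add the blocks of `S` to `T` one at a time and stop at the block with which `w` becomes
supported. -/
theorem exists_critical_block {S T : Finset (Fin l × ℚ)} {w : X} (hS : SupportedBy (m := m) S w)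
    (hT : ¬ SupportedBy (m := m) T w) :
    ∃ T' k q, T ⊆ T' ∧ SupportedBy (m := m) (insert (k, q) T') w ∧
      ¬ SupportedBy (m := m) T' w := by
  replace hS : SupportedBy (m := m) (T ∪ S) w := hS.mono Finset.subset_union_right
  induction S using Finset.induction_on with
  | empty => exact (hT (by simpa using hS)).elim
  | insert a S _ ih =>
    by_cases h : SupportedBy (m := m) (T ∪ S) w
    · exact ih h
    · exact ⟨T ∪ S, a.1, a.2, Finset.subset_union_left, by rwa [Finset.union_insert] at hS, h⟩

theorem finite_range_pow_smul {H : Subgroup (Equiv.Perm (BlockAtom m))} {w : X}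
    (hfin : (MulAction.orbit H w).Finite) {h : Equiv.Perm (BlockAtom m)} (hh : h ∈ H) :
    (Set.range fun i : ℕ => h ^ i • w).Finite :=
  hfin.subset (Set.range_subset_iff.2 fun i => ⟨⟨h ^ i, pow_mem hh i⟩, rfl⟩)

/-- An object with a finite orbit under the stabilizer of `T` is supported by `T`. -/
theorem supportedBy_of_finite_orbit {S T : Finset (Fin l × ℚ)} {w : X}
    (hS : SupportedBy (m := m) S w) (hfin : (MulAction.orbit (fixBlocks m T) w).Finite) :
    SupportedBy (m := m) T w := by
  by_contra hT
  obtain ⟨T', k, q, hTT', hw, hnw⟩ := exists_critical_block hS hT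
  -- Some `π` fixing `T'` moves the critical block, although the finite orbit forbids this.
  obtain ⟨π, hπ, q', hne, hπq⟩ := exists_mapsBlock_ne (m := m) (T := T') (k := k) (q := q)
    (fun hq => hnw (by rwa [Finset.insert_eq_of_mem hq] at hw))
  exact hne (hπq.unique (mapsBlock_self_of_finite hw hnw hπ
    (finite_range_pow_smul hfin (fixBlocks_anti hTT' hπ))))

/-- The rotation of block `q` is a homomorphism from `H` to ℤ/m_k whose kernel fixes `w`. The orbit
size is the index of the stabilizer, which divides the index of the kernel, that is, the order of
the image. -/
theorem card_orbit_dvd {T : Finset (Fin l × ℚ)} {k : Fin l} {q : ℚ} {w : X}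
    (hw : SupportedBy (m := m) (insert (k, q) T) w) {H : Subgroup (Equiv.Perm (BlockAtom m))}
    (hH : H ≤ fixBlocks m T) (hq : ∀ h ∈ H, MapsBlock h k q q) :
    (MulAction.orbit H w).ncard ∣ m k := by
  choose! c hc using hq
  let φ : H →* Multiplicative (ZMod (m k)) := MonoidHom.mk' (fun h => Multiplicative.ofAdd (c h.1))
    (by
      rintro ⟨a, ha⟩ ⟨b, hb⟩
      apply Multiplicative.toAdd.injective
      change c (a * b) = c a + c b
      have h1 := hc (a * b) (mul_mem ha hb) 0
      rw [Equiv.Perm.mul_apply, hc b hb, hc a ha] at h1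
      simp only [Sigma.mk.injEq, heq_eq_eq, Prod.mk.injEq, true_and, zero_add] at h1
      rw [← h1, add_comm])
  have hker : φ.ker ≤ MulAction.stabilizer H w := by
    rintro ⟨h, hh⟩ hφ
    have hφ' : c h = 0 := congrArg Multiplicative.toAdd (MonoidHom.mem_ker.1 hφ)
    refine hw h ⟨(hH hh).1, fun k' q' hk j => ?_⟩
    rcases Finset.mem_insert.1 hk with hk | hk
    · obtain ⟨rfl, rfl⟩ := Prod.mk.inj hk
      rw [hc h hh, hφ', add_zero]
    · exact (hH hh).2 k' q' hk j
  rw [← MulAction.index_stabilizer]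
  refine (Subgroup.index_dvd_of_le hker).trans ?_
  rw [Subgroup.index_ker]
  refine (Subgroup.card_subgroup_dvd_card φ.range).trans ?_
  rw [Nat.card_congr Multiplicative.toAdd, Nat.card_zmod]

theorem card_orbit_dvd_of_finite {T : Finset (Fin l × ℚ)} {k : Fin l} {q : ℚ} {w : X}
    (hw : SupportedBy (m := m) (insert (k, q) T) w) (hnw : ¬ SupportedBy (m := m) T w)
    {H : Subgroup (Equiv.Perm (BlockAtom m))} (hH : H ≤ fixBlocks m T)
    (hfin : (MulAction.orbit H w).Finite) : (MulAction.orbit H w).ncard ∣ m k :=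
  card_orbit_dvd hw hH fun _ hh =>
    mapsBlock_self_of_finite hw hnw (hH hh) (finite_range_pow_smul hfin hh)

end Supports

/-! ### Counting invariant subsets -/

section InvariantSubsets

/-- Greedy payment with coins that are powers of `p` dividing `n`: the largest coin is at most `n`,
and every other coin divides it, hence also the remaining amount. -/
theorem exists_subset_sum_eq {ι : Type*} [DecidableEq ι] (w : ι → ℕ) (p : ℕ) (s : Finset ι) :
    ∀ n : ℕ, (∀ i ∈ s, ∃ e, w i = p ^ e ∧ p ^ e ∣ n) → n ≤ ∑ i ∈ s, w i →
      ∃ t ⊆ s, ∑ i ∈ t, w i = n := by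
  induction hs : s.card generalizing s with
  | zero =>
    intro n _ hn
    rw [Finset.card_eq_zero] at hs
    subst hs
    exact ⟨∅, le_rfl, by simp at hn; simp [hn]⟩
  | succ a ih =>
    intro n h hn
    rcases Nat.eq_zero_or_pos n with rfl | hpos
    · exact ⟨∅, Finset.empty_subset _, rfl⟩
    choose! e he hdvd using h
    obtain ⟨i, hi, hmax⟩ := s.exists_max_image e (Finset.card_pos.1 (by omega))
    have hle : w i ≤ n := he i hi ▸ Nat.le_of_dvd hpos (hdvd i hi)
    obtain ⟨t, ht, hsum⟩ := ih (s.erase i) (by rw [Finset.card_erase_of_mem hi, hs]; rfl) (n - w i)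
      (fun j hj => by
        have hj' := Finset.mem_of_mem_erase hj
        refine ⟨e j, he j hj', Nat.dvd_sub (hdvd j hj') ?_⟩
        rw [he i hi]
        exact pow_dvd_pow p (hmax j hj'))
      (by
        have := Finset.add_sum_erase s w hi
        omega)
    refine ⟨insert i t, Finset.insert_subset hi (ht.trans (Finset.erase_subset _ _)), ?_⟩
    rw [Finset.sum_insert fun hit => Finset.notMem_erase i s (ht hit), hsum]
    omega

/-- The orbits in `Z` are the coins, weighted by their sizes; a subfamily of total size `n` has the
required union. -/
theorem exists_invariant_subset {H X : Type*} [Group H] [MulAction H X] {Z : Set X}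
    (hZ : Z.Finite) (hinv : ∀ (h : H), ∀ w ∈ Z, h • w ∈ Z) (p n : ℕ)
    (horb : ∀ w ∈ Z, ∃ e, (MulAction.orbit H w).ncard = p ^ e ∧ p ^ e ∣ n) (hn : n ≤ Z.ncard) :
    ∃ S ⊆ Z, S.ncard = n ∧ ∀ (h : H), ∀ w ∈ S, h • w ∈ S := by
  classical
  lift Z to Finset X using hZ
  rw [Set.ncard_coe_finset] at hn
  simp only [Finset.mem_coe] at hinv horb
  have hfib : ∀ w ∈ Z,
      (Z.filter fun x => MulAction.orbit H x = MulAction.orbit H w).card =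
        (MulAction.orbit H w).ncard := by
    intro w hw
    rw [← Set.ncard_coe_finset]
    congr 1
    ext x
    simp only [Finset.coe_filter, Set.mem_ofPred_eq, MulAction.orbit_eq_iff]
    refine ⟨fun h => h.2, fun h => ⟨?_, h⟩⟩
    obtain ⟨g, rfl⟩ := h
    exact hinv g w hw
  obtain ⟨t, ht, hsum⟩ := exists_subset_sum_eq Set.ncard p (Z.image (MulAction.orbit H)) n
    (by simpa using horb) (by
      refine hn.trans (le_of_eq ?_)
      rw [Finset.card_eq_sum_card_image (MulAction.orbit H) Z]
      refine Finset.sum_congr rfl fun o ho => ?_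
      obtain ⟨w, hw, rfl⟩ := Finset.mem_image.1 ho
      exact hfib w hw)
  refine ⟨Z.filter fun x => MulAction.orbit H x ∈ t,
    Finset.coe_subset.2 (Finset.filter_subset _ _), ?_, ?_⟩
  · rw [Set.ncard_coe_finset, ← hsum, Finset.card_eq_sum_card_fiberwise (f := MulAction.orbit H)
      (t := t) (fun x hx => by simpa using (Finset.mem_filter.1 hx).2)]
    refine Finset.sum_congr rfl fun o ho => ?_
    obtain ⟨w, hw, rfl⟩ := Finset.mem_image.1 (ht ho)
    rw [← hfib w hw, Finset.filter_filter]
    congr 1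
    refine Finset.filter_congr fun x _ => ⟨fun h => h.2, fun h => ⟨h ▸ ho, h⟩⟩
  · intro h w hw
    simp only [Finset.coe_filter, Set.mem_ofPred_eq] at hw ⊢
    exact ⟨hinv h w hw.1, by rw [MulAction.orbit_smul]; exact hw.2⟩

theorem dvd_ncard_of_rotation_invariant {ι : Type*} [Finite ι] {m : ℕ} [NeZero m]
    {S : Set (ι × ZMod m)} (hS : ∀ i j, (i, j) ∈ S → (i, j + 1) ∈ S) : m ∣ S.ncard := by
  have h1 : ∀ (i : ι) (j : ZMod m) (a : ℕ), (i, j) ∈ S → (i, j + a) ∈ S := by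
    intro i j a h
    induction a with
    | zero => simpa using h
    | succ a ih =>
      rw [Nat.cast_succ, ← add_assoc]
      exact hS _ _ ih
  have h2 : S = {i | (i, (0 : ZMod m)) ∈ S} ×ˢ Set.univ := by
    ext ⟨i, j⟩
    simp only [Set.mem_prod, Set.mem_ofPred_eq, Set.mem_univ, and_true]
    constructor
    · intro h
      have := h1 i j (-j).val h
      rwa [ZMod.natCast_val, ZMod.cast_id, add_neg_cancel] at this
    · intro h
      have := h1 i 0 j.val h
      rwa [ZMod.natCast_val, ZMod.cast_id, zero_add] at this
  rw [h2, Set.ncard_prod, Set.ncard_univ, Nat.card_zmod]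
  exact dvd_mul_left _ _

end InvariantSubsets

/-! ### Absoluteness of the basic notions in a permutation model -/

section PermutationModel

open ZFAUniverse

variable {A : Type} {G : Subgroup (Equiv.Perm A)}

theorem coe_injective_dom :
    Function.Injective (fun x : (permutationModel.{u} A G).Dom => x.1) := Subtype.val_injective

theorem image_coe_mem (x : (permutationModel.{u} A G).Dom) :
    (fun w : (permutationModel.{u} A G).Dom => w.1) '' {w | (permutationModel.{u} A G).mem w x} =
      elts x.1 := by
  ext w
  constructor
  · rintro ⟨w, hw, rfl⟩
    exact hw
  · intro hw
    exact ⟨⟨w, x.2.of_mem hw⟩, hw, rfl⟩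

theorem encard_mem (x : (permutationModel.{u} A G).Dom) :
    {w | (permutationModel.{u} A G).mem w x}.encard = (elts x.1).encard := by
  rw [← image_coe_mem, coe_injective_dom.encard_image]

theorem dom_ext {x y : (permutationModel.{u} A G).Dom}
    (hx : (permutationModel.{u} A G).IsSet x) (hy : (permutationModel.{u} A G).IsSet y)
    (h : ∀ w, (permutationModel.{u} A G).mem w x ↔ (permutationModel.{u} A G).mem w y) :
    x = y := by
  apply Subtype.ext
  refine ext_of_not_isAtom hx hy ?_
  rw [← image_coe_mem, ← image_coe_mem]
  congr 1
  ext w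
  exact h w

theorem isUnorderedPair_iff {w x y : (permutationModel.{u} A G).Dom} :
    (permutationModel.{u} A G).IsUnorderedPair w x y ↔ w.1 = upair x.1 y.1 := by
  constructor
  · rintro ⟨h1, h2⟩
    refine ext_of_not_isAtom h1 (not_isAtom_ofSet _) ?_
    rw [← image_coe_mem, elts_upair]
    ext v
    simp only [Set.mem_image, Set.mem_ofPred_eq, h2, Set.mem_insert_iff, Set.mem_singleton_iff]
    constructor
    · rintro ⟨v, rfl | rfl, rfl⟩ <;> simp
    · rintro (rfl | rfl)
      · exact ⟨x, Or.inl rfl, rfl⟩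
      · exact ⟨y, Or.inr rfl, rfl⟩
  · intro h
    refine ⟨?_, fun v => ?_⟩
    · change ¬ IsAtom w.1
      rw [h]
      exact not_isAtom_ofSet _
    · change v.1 ∈ elts w.1 ↔ _
      rw [h, elts_upair]
      exact or_congr ⟨fun h => Subtype.ext h, fun h => congrArg Subtype.val h⟩
        ⟨fun h => Subtype.ext h, fun h => congrArg Subtype.val h⟩

theorem isPair_iff {w x y : (permutationModel.{u} A G).Dom} :
    (permutationModel.{u} A G).IsPair w x y ↔ w.1 = opair x.1 y.1 := by
  simp only [ZFAStructure.IsPair, isUnorderedPair_iff]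
  constructor
  · rintro ⟨s, t, h1, h2, h3⟩
    rw [h3, h1, h2, opair]
  · intro h
    exact ⟨⟨_, hereditarilySymmetric_upair x.2 x.2⟩, ⟨_, hereditarilySymmetric_upair x.2 y.2⟩,
      rfl, rfl, h⟩

theorem maps_iff {f x y : (permutationModel.{u} A G).Dom} :
    (permutationModel.{u} A G).Maps f x y ↔ opair x.1 y.1 ∈ elts f.1 := by
  simp only [ZFAStructure.Maps, isPair_iff]
  constructor
  · rintro ⟨w, h1, h2⟩
    rw [← h1]
    exact h2
  · intro h
    exact ⟨⟨_, hereditarilySymmetric_opair x.2 y.2⟩, rfl, h⟩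

/-- Only the symmetry of the graph needs proof, as its elements are pairs of objects of the model.
-/
theorem exists_isFunctionOn {P : (permutationModel.{u} A G).Dom → Prop}
    (F : (permutationModel.{u} A G).Dom → (permutationModel.{u} A G).Dom)
    (hP : Small.{u} {z | P z})
    (hF : Symmetric G (ofSet ((fun z => opair z.1 (F z).1) '' {z | P z}))) :
    ∃ f, (permutationModel.{u} A G).IsFunctionOn f P ∧
      ∀ z v, (permutationModel.{u} A G).Maps f z v ↔ P z ∧ v = F z := by
  have hs : Small.{u} ((fun z : (permutationModel.{u} A G).Dom => opair z.1 (F z).1) ''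
    {z | P z}) := small_image _ _
  have helts := elts_ofSet hs
  let f : (permutationModel.{u} A G).Dom := ⟨ofSet _, hereditarilySymmetric_iff.2 ⟨hF, by
    rw [helts]
    rintro _ ⟨z, -, rfl⟩
    exact hereditarilySymmetric_opair z.2 (F z).2⟩⟩
  have hmaps : ∀ z v, (permutationModel.{u} A G).Maps f z v ↔ P z ∧ v = F z := by
    intro z v
    rw [maps_iff, helts]
    constructor
    · rintro ⟨z', hz', h⟩
      obtain ⟨h1, h2⟩ := opair_inj.1 h
      obtain rfl := Subtype.ext h1
      exact ⟨hz', (Subtype.ext h2).symm⟩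
    · rintro ⟨hz, rfl⟩
      exact ⟨z, hz, rfl⟩
  refine ⟨f, ⟨not_isAtom_ofSet _, fun w hw => ?_, fun z hz => ?_⟩, hmaps⟩
  · have hw' : w.1 ∈ elts (ofSet _) := hw
    rw [helts] at hw'
    obtain ⟨z, hz, h⟩ := hw'
    exact ⟨z, F z, hz, isPair_iff.2 h.symm⟩
  · exact ⟨F z, (hmaps _ _).2 ⟨hz, rfl⟩, fun v hv => ((hmaps _ _).1 hv).2⟩

/-- The von Neumann natural numbers in the model. -/
noncomputable def natDom (A : Type) (G : Subgroup (Equiv.Perm A)) (n : ℕ) :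
    (permutationModel.{u} A G).Dom := ⟨vonNeumann n, hereditarilySymmetric_vonNeumann n⟩

theorem mem_natDom {w : (permutationModel.{u} A G).Dom} {n : ℕ} :
    (permutationModel.{u} A G).mem w (natDom A G n) ↔ ∃ i < n, w = natDom A G i := by
  change w.1 ∈ elts (vonNeumann n) ↔ _
  rw [elts_vonNeumann]
  constructor
  · rintro ⟨i, hi, h⟩
    exact ⟨i, hi, Subtype.ext h.symm⟩
  · rintro ⟨i, hi, rfl⟩
    exact ⟨i, hi, rfl⟩

theorem isSet_natDom (n : ℕ) : (permutationModel.{u} A G).IsSet (natDom A G n) :=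
  not_isAtom_vonNeumann n

theorem isEmptySet_natDom_zero :
    (permutationModel.{u} A G).IsEmptySet (natDom A G 0) :=
  ⟨isSet_natDom 0, fun w hw => by
    obtain ⟨i, hi, -⟩ := mem_natDom.1 hw
    omega⟩

theorem isSuccessor_natDom (n : ℕ) :
    (permutationModel.{u} A G).IsSuccessor (natDom A G (n + 1)) (natDom A G n) := by
  refine ⟨isSet_natDom _, fun w => ?_⟩
  simp only [mem_natDom, Nat.lt_succ_iff_lt_or_eq]
  constructor
  · rintro ⟨i, hi | rfl, rfl⟩
    · exact Or.inl ⟨i, hi, rfl⟩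
    · exact Or.inr rfl
  · rintro (⟨i, hi, rfl⟩ | rfl)
    · exact ⟨i, Or.inl hi, rfl⟩
    · exact ⟨n, Or.inr rfl, rfl⟩

theorem isNatural_natDom (n : ℕ) :
    (permutationModel.{u} A G).IsNatural (natDom A G n) := by
  intro I hI
  induction n with
  | zero =>
    obtain ⟨e, he, heI⟩ := hI.2.1
    rwa [dom_ext (isSet_natDom 0) he.1 fun w =>
      ⟨fun h => (isEmptySet_natDom_zero.2 w h).elim, fun h => (he.2 w h).elim⟩]
  | succ n ih =>
    obtain ⟨y, hy, hyI⟩ := hI.2.2 _ ih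
    rwa [dom_ext (isSet_natDom (n + 1)) hy.1 fun w =>
      ((isSuccessor_natDom n).2 w).trans (hy.2 w).symm]

/-- The true ω is fixed by all permutations, so it is an inductive set of the model, and a natural
number of the model belongs to it. -/
theorem exists_eq_natDom {x : (permutationModel.{u} A G).Dom}
    (hx : (permutationModel.{u} A G).IsNatural x) : ∃ n, x = natDom A G n := by
  have hs : Small.{u} (Set.range (vonNeumann : ℕ → ZFAUniverse.{u} A)) := small_range _
  have helts := elts_ofSet hs
  let I : (permutationModel.{u} A G).Dom :=
    ⟨ofSet (Set.range vonNeumann), hereditarilySymmetric_of_fixed (fun π _ => by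
      rw [smul_ofSet π hs, ← Set.image_smul, ← Set.range_comp]
      congr 1
      congr 1
      ext n
      exact smul_vonNeumann π n) (by
        rw [helts]
        rintro _ ⟨n, rfl⟩
        exact hereditarilySymmetric_vonNeumann n)⟩
  have hI : ∀ w, (permutationModel.{u} A G).mem w I ↔ ∃ n, w = natDom A G n := by
    intro w
    change w.1 ∈ elts (ofSet _) ↔ _
    rw [helts]
    exact exists_congr fun n => ⟨fun h => Subtype.ext h.symm, fun h => h ▸ rfl⟩
  refine (hI x).1 (hx I ⟨not_isAtom_ofSet _, ⟨_, isEmptySet_natDom_zero, (hI _).2 ⟨0, rfl⟩⟩, ?_⟩)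
  intro y hy
  obtain ⟨n, rfl⟩ := (hI y).1 hy
  exact ⟨_, isSuccessor_natDom n, (hI _).2 ⟨n + 1, rfl⟩⟩

/-- A set is finite in the model if and only if it is finite. -/
theorem isFiniteSet_iff {x : (permutationModel.{u} A G).Dom} :
    (permutationModel.{u} A G).IsFiniteSet x ↔ ¬ IsAtom x.1 ∧ (elts x.1).Finite := by
  refine and_congr Iff.rfl ?_
  rw [← image_coe_mem, Set.finite_image_iff coe_injective_dom.injOn]
  constructor
  · rintro ⟨i, g, hi, hg⟩
    obtain ⟨n, rfl⟩ := exists_eq_natDom hi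
    have hex : ∀ v, (permutationModel.{u} A G).mem v x →
        ∃ i < n, (permutationModel.{u} A G).Maps g (natDom A G i) v := by
      intro v hv
      obtain ⟨w, hw, -⟩ := hg.2.2 v hv
      obtain ⟨p, hp, hpg⟩ := hw
      obtain ⟨w', v', hw', hp'⟩ := hg.1.2.1 p hpg
      rw [isPair_iff] at hp hp'
      obtain rfl := Subtype.ext (opair_inj.1 (hp.symm.trans hp')).1
      obtain ⟨i, hi, rfl⟩ := mem_natDom.1 hw'
      exact ⟨i, hi, p, isPair_iff.2 hp, hpg⟩
    choose! F hF hF' using hex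
    refine Set.Finite.of_finite_image ((Set.finite_Iio n).subset
      (Set.image_subset_iff.2 hF)) (f := F) fun v hv w hw h => ?_
    have h1 := hF' v hv
    have h2 := hF' w hw
    rw [← h] at h2
    exact (hg.1.2.2 _ (mem_natDom.2 ⟨F v, hF v hv, rfl⟩)).unique h1 h2
  · intro hfin
    have := hfin.to_subtype
    obtain ⟨n, ⟨e⟩⟩ := Finite.exists_equiv_fin {w | (permutationModel.{u} A G).mem w x}
    have : Nonempty (permutationModel.{u} A G).Dom := ⟨x⟩
    have hex : ∀ z, (permutationModel.{u} A G).mem z (natDom A G n) →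
        ∃ v, ∃ i : Fin n, z = natDom A G i ∧ v = (e.symm i).1 := by
      intro z hz
      obtain ⟨i, hi, rfl⟩ := mem_natDom.1 hz
      exact ⟨_, ⟨i, hi⟩, rfl, rfl⟩
    choose! F hF using hex
    have hPfin : {z | (permutationModel.{u} A G).mem z (natDom A G n)}.Finite := by
      refine ((Set.finite_Iio n).image (natDom A G)).subset fun z hz => ?_
      obtain ⟨i, hi, rfl⟩ := mem_natDom.1 hz
      exact ⟨i, hi, rfl⟩
    obtain ⟨g, hg, hgm⟩ := exists_isFunctionOn
      (P := fun z => (permutationModel.{u} A G).mem z (natDom A G n)) F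
      (by have := hPfin.countable.to_subtype; infer_instance)
      (hereditarilySymmetric_iff.1 (hereditarilySymmetric_ofSet (hPfin.image _) (by
        rintro _ ⟨z, -, rfl⟩
        exact hereditarilySymmetric_opair z.2 (F z).2))).1
    refine ⟨natDom A G n, g, isNatural_natDom n, hg, fun i v hv => ?_, fun v hv => ?_⟩
    · obtain ⟨hi, rfl⟩ := (hgm i v).1 hv
      obtain ⟨j, -, hj⟩ := hF i hi
      rw [hj]
      exact (e.symm j).2
    · have hinj : ∀ i j : ℕ, natDom A G i = natDom A G j → i = j := fun i j h =>
        vonNeumann_injective (congrArg Subtype.val h)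
      have hmem : (permutationModel.{u} A G).mem (natDom A G (e ⟨v, hv⟩)) (natDom A G n) :=
        mem_natDom.2 ⟨_, (e ⟨v, hv⟩).2, rfl⟩
      refine ⟨natDom A G (e ⟨v, hv⟩), (hgm _ _).2 ⟨hmem, ?_⟩, fun z hz => ?_⟩
      · obtain ⟨j, hj, hj'⟩ := hF _ hmem
        rw [hj', ← Fin.ext (hinj _ _ hj), Equiv.symm_apply_apply]
      · obtain ⟨hz', rfl⟩ := (hgm _ _).1 hz
        obtain ⟨j, hj, hj'⟩ := hF z hz'
        have : (⟨F z, hv⟩ : {w | (permutationModel.{u} A G).mem w x}) = e.symm j :=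
          Subtype.ext hj'
        rw [this, Equiv.apply_symm_apply, hj]

theorem hasCard_iff {x : (permutationModel.{u} A G).Dom} {n : ℕ} :
    (permutationModel.{u} A G).HasCard x n ↔ ¬ IsAtom x.1 ∧ (elts x.1).encard = n := by
  rw [ZFAStructure.HasCard, encard_mem]
  rfl

theorem subset_iff {x y : (permutationModel.{u} A G).Dom} :
    (permutationModel.{u} A G).Subset x y ↔ ¬ IsAtom x.1 ∧ ¬ IsAtom y.1 ∧ elts x.1 ⊆ elts y.1 := by
  refine and_congr Iff.rfl (and_congr Iff.rfl ⟨fun h w hw => ?_, fun h w hw => h hw⟩)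
  exact h ⟨w, x.2.of_mem hw⟩ hw

theorem isInfiniteSet_iff {x : (permutationModel.{u} A G).Dom} :
    (permutationModel.{u} A G).IsInfiniteSet x ↔ ¬ IsAtom x.1 ∧ (elts x.1).Infinite := by
  rw [ZFAStructure.IsInfiniteSet, isFiniteSet_iff]
  change ¬ IsAtom x.1 ∧ _ ↔ _
  rw [Set.Infinite]
  tauto

theorem isFiniteSetOfCardGT_iff {x : (permutationModel.{u} A G).Dom} {n : ℕ} :
    (permutationModel.{u} A G).IsFiniteSetOfCardGT x n ↔
      ¬ IsAtom x.1 ∧ (elts x.1).Finite ∧ n < (elts x.1).ncard := by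
  rw [ZFAStructure.IsFiniteSetOfCardGT, isFiniteSet_iff, encard_mem, and_assoc]
  refine and_congr Iff.rfl (and_congr_right fun h => ?_)
  rw [← h.cast_ncard_eq, Nat.cast_lt]

theorem smul_value_eq {P : (permutationModel.{u} A G).Dom → Prop}
    {f z v : (permutationModel.{u} A G).Dom} (hf : (permutationModel.{u} A G).IsFunctionOn f P)
    (hz : P z) (hv : (permutationModel.{u} A G).Maps f z v) {π : Equiv.Perm A}
    (hπf : π • f.1 = f.1) (hπz : π • z.1 = z.1) : π • v.1 = v.1 := by
  have h1 := Mem.smul π (maps_iff.1 hv)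
  rw [smul_opair, hπf, hπz] at h1
  -- Uniqueness of values holds only within the model; `π • v` lies there as a component of an
  -- element of `f`.
  have h2 : HereditarilySymmetric G (opair z.1 (π • v.1)) := f.2.of_mem h1
  have h3 : upair z.1 (π • v.1) ∈ elts (opair z.1 (π • v.1)) := by
    rw [opair, elts_upair]
    exact Or.inr rfl
  have h4 : π • v.1 ∈ elts (upair z.1 (π • v.1)) := by
    rw [elts_upair]
    exact Or.inr rfl
  exact congrArg Subtype.val
    ((hf.2.2 z hz).unique (y₁ := ⟨π • v.1, (h2.of_mem h3).of_mem h4⟩) (maps_iff.2 h1) hv)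

end PermutationModel

/-- An invariant choice on the members of a `K`-stable set can be made equivariantly. -/
theorem exists_equivariant_choice {K X Y : Type*} [Group K] [MulAction K X] [MulAction K Y]
    {D : Set X} (hD : ∀ (k : K), ∀ x ∈ D, k • x ∈ D) (S : X → Y)
    (hS : ∀ x ∈ D, ∀ k : K, k • x = x → k • S x = S x) :
    ∃ φ : X → Y, (∀ x ∈ D, ∀ k : K, φ (k • x) = k • φ x) ∧
      ∀ x ∈ D, ∃ k : K, ∃ r ∈ D, x = k • r ∧ φ x = k • S r := by
  let rep : X → X := fun x => (Quotient.mk (MulAction.orbitRel K X) x).out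
  have hrep : ∀ x, ∃ g : K, g • rep x = x := by
    intro x
    obtain ⟨g, hg⟩ : rep x ∈ MulAction.orbit K x :=
      MulAction.orbitRel_apply.1 (Quotient.mk_out (s := MulAction.orbitRel K X) x)
    exact ⟨g⁻¹, by rw [← hg, inv_smul_smul]⟩
  choose g hg using hrep
  have hrepD : ∀ x ∈ D, rep x ∈ D := by
    intro x hx
    have := hD (g x)⁻¹ x hx
    nth_rewrite 2 [← hg x] at this
    rwa [inv_smul_smul] at this
  have hsmul : ∀ (k : K) (x : X), rep (k • x) = rep x := fun k x =>
    congrArg Quotient.out (Quotient.sound (s := MulAction.orbitRel K X)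
      (MulAction.orbitRel_apply.2 ⟨k, rfl⟩))
  refine ⟨fun x => g x • S (rep x), fun x hx k => ?_, fun x hx =>
    ⟨g x, rep x, hrepD x hx, (hg x).symm, rfl⟩⟩
  -- Two elements carrying the representative to `k • x` differ by one that fixes it, and hence
  -- fixes its chosen value.
  have h1 : (k * g x)⁻¹ • g (k • x) • rep x = rep x := by
    rw [inv_smul_eq_iff, mul_smul, hg x, ← hsmul k x, hg]
  rw [← mul_smul] at h1
  have h2 := hS _ (hrepD x hx) _ h1
  rw [mul_smul, inv_smul_eq_iff, mul_smul] at h2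
  change g (k • x) • S (rep (k • x)) = k • g x • S (rep x)
  rw [hsmul, h2]

/-! ### Choice functions and orbits in the block model -/

section BlockModel

open ZFAUniverse

variable {l : ℕ} {m : Fin l → ℕ}

/-- One atom from each block suffices: a rotation with a fixed point is trivial. -/
theorem SupportedBy.symmetric {T : Finset (Fin l × ℚ)} {x : ZFAUniverse.{u} (BlockAtom m)}
    (h : SupportedBy (m := m) T x) : Symmetric (blockGroup m) x := by
  refine ⟨(fun b => ⟨b.1, b.2, 0⟩) '' (T : Set (Fin l × ℚ)), T.finite_toSet.image _,
    fun g hg => h g.1 ⟨g.2, fun k q hk j => ?_⟩⟩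
  have h1 : g.1 ⟨k, q, 0⟩ = ⟨k, q, 0⟩ := hg ⟨(k, q), hk, rfl⟩
  obtain ⟨σ, c, h2⟩ := g.2
  rw [h2] at h1 ⊢
  simp only [Sigma.mk.injEq, heq_eq_eq, Prod.mk.injEq, true_and, zero_add] at h1
  rw [h1.1, h1.2, add_zero]

theorem exists_supportedBy {x : ZFAUniverse.{u} (BlockAtom m)}
    (h : HereditarilySymmetric (blockGroup m) x) :
    ∃ T : Finset (Fin l × ℚ), SupportedBy (m := m) T x := by
  classical
  obtain ⟨E, hE, hx⟩ := (hereditarilySymmetric_iff.1 h).1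
  refine ⟨hE.toFinset.image fun a => (a.1, a.2.1), fun π hπ => hx ⟨π, hπ.1⟩ fun a ha => ?_⟩
  exact hπ.2 a.1 a.2.1 (Finset.mem_image.2 ⟨a, hE.mem_toFinset.2 ha, rfl⟩) a.2.2

/-- The choice is made outside the model, equivariantly under `fixBlocks m T`; its graph is then
supported by `T` and belongs to the model. -/
theorem exists_choice_function {D : Set (ZFAUniverse.{u} (BlockAtom m))} (hsmall : Small.{u} D)
    (hHS : ∀ z ∈ D, HereditarilySymmetric (blockGroup m) z) (hset : ∀ z ∈ D, ¬ IsAtom z)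
    (hfin : ∀ z ∈ D, (elts z).Finite) {T : Finset (Fin l × ℚ)} {n : ℕ}
    (hinv : ∀ π ∈ fixBlocks m T, ∀ z ∈ D, π • z ∈ D)
    (hch : ∀ z ∈ D, ∃ S ⊆ elts z, S.ncard = n ∧
      ∀ π ∈ fixBlocks m T, π • z = z → π • S = S) :
    ∃ f, (blockModel.{u} m).IsFunctionOn f (fun z => z.1 ∈ D) ∧
      ∀ z v, (blockModel.{u} m).Maps f z v →
        (blockModel.{u} m).HasCard v n ∧ (blockModel.{u} m).Subset v z := by
  choose! S hS hSn hSinv using hch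
  obtain ⟨φ, hφ, hφS⟩ := exists_equivariant_choice (K := fixBlocks m T) (D := D)
    (fun k x hx => hinv k.1 k.2 x hx) S (fun x hx k hk => hSinv x hx k.1 k.2 hk)
  have hsub : ∀ z ∈ D, φ z ⊆ elts z ∧ (φ z).ncard = n := by
    intro z hz
    obtain ⟨k, r, hr, rfl, h⟩ := hφS z hz
    rw [h]
    constructor
    · change k.1 • S r ⊆ elts (k.1 • r)
      rw [elts_smul]
      exact Set.smul_set_mono (hS r hr)
    · rw [← hSn r hr, ← Set.image_smul, Set.ncard_image_of_injective _ (MulAction.injective k)]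
  have hφfin : ∀ z ∈ D, (φ z).Finite := fun z hz => (hfin z hz).subset (hsub z hz).1
  have hval : ∀ z : (blockModel.{u} m).Dom, ∃ v : (blockModel.{u} m).Dom,
      z.1 ∈ D → v.1 = ofSet (φ z.1) := by
    intro z
    by_cases hz : z.1 ∈ D
    · exact ⟨⟨_, hereditarilySymmetric_ofSet (hφfin _ hz) fun y hy =>
        z.2.of_mem ((hsub _ hz).1 hy)⟩, fun _ => rfl⟩
    -- A dummy value outside `D`.
    · exact ⟨z, fun h => (hz h).elim⟩
  choose F hF using hval
  have hs1 : Small.{u} {z : (blockModel.{u} m).Dom | z.1 ∈ D} :=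
    small_of_injective (f := fun z => (⟨z.1.1, z.2⟩ : D)) fun z w h =>
      Subtype.ext (Subtype.ext (Subtype.mk.inj h))
  have himage : (fun z : (blockModel.{u} m).Dom => opair z.1 (F z).1) '' {z | z.1 ∈ D} =
      (fun z => opair z (ofSet (φ z))) '' D := by
    ext w
    constructor
    · rintro ⟨z, hz, rfl⟩
      exact ⟨z.1, hz, congrArg (opair z.1) (hF z hz).symm⟩
    · rintro ⟨z, hz, rfl⟩
      exact ⟨⟨z, hHS z hz⟩, hz, congrArg (opair z) (hF ⟨z, hHS z hz⟩ hz)⟩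
  have hsub2 : ∀ π ∈ fixBlocks m T, ∀ z ∈ D, π • opair z (ofSet (φ z)) =
      opair (π • z) (ofSet (φ (π • z))) := by
    intro π hπ z hz
    rw [smul_opair, smul_ofSet π (small_of_finite (hφfin z hz))]
    congr 2
    exact (hφ z hz ⟨π, hπ⟩).symm
  have hsupp : SupportedBy (m := m) T (ofSet ((fun z => opair z (ofSet (φ z))) '' D)) := by
    intro π hπ
    rw [smul_ofSet π (small_image _ _)]
    congr 1
    apply Set.Subset.antisymm
    · rw [← Set.image_smul]
      rintro _ ⟨_, ⟨z, hz, rfl⟩, rfl⟩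
      exact ⟨π • z, hinv π hπ z hz, (hsub2 π hπ z hz).symm⟩
    · rintro _ ⟨z, hz, rfl⟩
      rw [Set.mem_smul_set_iff_inv_smul_mem]
      have hπ' := inv_mem hπ
      exact ⟨π⁻¹ • z, hinv _ hπ' z hz, (hsub2 _ hπ' z hz).symm⟩
  obtain ⟨f, hf, hfm⟩ := exists_isFunctionOn (G := blockGroup m) (P := fun z => z.1 ∈ D) F hs1
    (by
      have := hsupp.symmetric
      rwa [← himage] at this)
  refine ⟨f, hf, fun z v hv => ?_⟩
  obtain ⟨hz, rfl⟩ := (hfm z v).1 hv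
  have helts : elts (F z).1 = φ z.1 := by
    rw [hF z hz, elts_ofSet (small_of_finite (hφfin _ hz))]
  have hat : ¬ IsAtom (F z).1 := by
    rw [hF z hz]
    exact not_isAtom_ofSet _
  refine ⟨hasCard_iff.2 ⟨hat, ?_⟩, subset_iff.2 ⟨hat, hset _ hz, ?_⟩⟩
  · rw [helts, ← (hφfin _ hz).cast_ncard_eq, (hsub _ hz).2]
  · rw [helts]
    exact (hsub _ hz).1

theorem smul_mem_elts {x w : ZFAUniverse.{u} (BlockAtom m)} {π : Equiv.Perm (BlockAtom m)}
    (hπ : π • x = x) (hw : w ∈ elts x) : π • w ∈ elts x := by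
  have := Mem.smul π hw
  rwa [hπ] at this

theorem exists_choice_function_of_orbits {D : Set (ZFAUniverse.{u} (BlockAtom m))}
    (hsmall : Small.{u} D) (hHS : ∀ z ∈ D, HereditarilySymmetric (blockGroup m) z)
    (hset : ∀ z ∈ D, ¬ IsAtom z) (hfin : ∀ z ∈ D, (elts z).Finite) {T : Finset (Fin l × ℚ)}
    {n : ℕ} (hcard : ∀ z ∈ D, n < (elts z).ncard)
    (hinv : ∀ π ∈ fixBlocks m T, ∀ z ∈ D, π • z ∈ D) (p : ℕ)
    (horb : ∀ z ∈ D, ∀ w ∈ elts z, ∀ H ≤ fixBlocks m T, (MulAction.orbit H w).Finite →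
      ∃ e, (MulAction.orbit H w).ncard = p ^ e ∧ p ^ e ∣ n) :
    ∃ f, (blockModel.{u} m).IsFunctionOn f (fun z => z.1 ∈ D) ∧
      ∀ z v, (blockModel.{u} m).Maps f z v →
        (blockModel.{u} m).HasCard v n ∧ (blockModel.{u} m).Subset v z := by
  refine exists_choice_function hsmall hHS hset hfin hinv fun z hz => ?_
  -- Invariance of the chosen subset is needed only under the permutations that fix `z`.
  let H : Subgroup (Equiv.Perm (BlockAtom m)) :=
    fixBlocks m T ⊓ MulAction.stabilizer (Equiv.Perm (BlockAtom m)) z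
  have hH : ∀ (h : H), ∀ w ∈ elts z, h • w ∈ elts z := fun h w hw => smul_mem_elts h.2.2 hw
  obtain ⟨S, hS, hSn, hSinv⟩ := exists_invariant_subset (H := H) (hfin z hz) hH p n
    (fun w hw => horb z hz w hw H inf_le_left ((hfin z hz).subset (by
      rintro _ ⟨h, rfl⟩
      exact hH h w hw))) (hcard z hz).le
  refine ⟨S, hS, hSn, fun π hπ hπz => ?_⟩
  have hπH : π ∈ H := ⟨hπ, hπz⟩
  apply Set.Subset.antisymm
  · rw [← Set.image_smul]
    rintro _ ⟨w, hw, rfl⟩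
    exact hSinv ⟨π, hπH⟩ w hw
  · intro w hw
    rw [Set.mem_smul_set_iff_inv_smul_mem]
    exact hSinv ⟨π⁻¹, inv_mem hπH⟩ w hw

theorem SupportedBy.ncard_orbit {X : Type*} [MulAction (Equiv.Perm (BlockAtom m)) X]
    {T : Finset (Fin l × ℚ)} {w : X} (h : SupportedBy (m := m) T w)
    {H : Subgroup (Equiv.Perm (BlockAtom m))} (hH : H ≤ fixBlocks m T) :
    (MulAction.orbit H w).ncard = 1 := by
  rw [Set.ncard_eq_one]
  refine ⟨w, Set.Subset.antisymm ?_ (Set.singleton_subset_iff.2 (MulAction.mem_orbit_self w))⟩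
  rintro _ ⟨g, rfl⟩
  exact h g.1 (hH g.2)

/-- The orbit stays inside `x` because `T'` contains a support of `x`, and it is infinite because a
finite one would make `T'` a support of `x₀`. -/
theorem exists_orbit_dom {x x₀ : ZFAUniverse.{u} (BlockAtom m)}
    (hx : HereditarilySymmetric (blockGroup m) x) (hx₀ : x₀ ∈ elts x)
    {T T' : Finset (Fin l × ℚ)} (hT : SupportedBy (m := m) T x) (hTT' : T ⊆ T')
    (hn : ¬ SupportedBy (m := m) T' x₀) :
    ∃ y : ZFAUniverse.{u} (BlockAtom m), HereditarilySymmetric (blockGroup m) y ∧ ¬ IsAtom y ∧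
      elts y ⊆ elts x ∧ (elts y).Infinite ∧ SupportedBy (m := m) T' y ∧
      elts y = MulAction.orbit (fixBlocks m T') x₀ := by
  have hsmall : Small.{u} (MulAction.orbit (fixBlocks m T') x₀) := small_range _
  have helts := elts_ofSet hsmall
  have hsub : MulAction.orbit (fixBlocks m T') x₀ ⊆ elts x := by
    rintro _ ⟨g, rfl⟩
    exact smul_mem_elts (hT g.1 (fixBlocks_anti hTT' g.2)) hx₀
  have hsupp : SupportedBy (m := m) T' (ofSet (MulAction.orbit (fixBlocks m T') x₀)) := by
    intro π hπ
    rw [smul_ofSet π hsmall]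
    congr 1
    exact MulAction.smul_orbit (⟨π, hπ⟩ : fixBlocks m T') x₀
  obtain ⟨S, hS⟩ := exists_supportedBy (hx.of_mem hx₀)
  refine ⟨_, ?_, not_isAtom_ofSet _, helts.trans_subset hsub, ?_, hsupp, helts⟩
  · refine hereditarilySymmetric_iff.2 ⟨hsupp.symmetric, ?_⟩
    rw [helts]
    exact fun y hy => hx.of_mem (hsub hy)
  · rw [helts]
    exact fun hfin => hn (supportedBy_of_finite_orbit hS hfin)

theorem exists_insert_supportedBy_of_mem_orbit {X : Type*}
    [MulAction (Equiv.Perm (BlockAtom m)) X] {T : Finset (Fin l × ℚ)} {k : Fin l} {q : ℚ}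
    {w w₀ : X} (h : SupportedBy (m := m) (insert (k, q) T) w₀) (hn : ¬ SupportedBy (m := m) T w₀)
    (hw : w ∈ MulAction.orbit (fixBlocks m T) w₀) :
    ∃ q', SupportedBy (m := m) (insert (k, q') T) w ∧ ¬ SupportedBy (m := m) T w := by
  obtain ⟨g, rfl⟩ := hw
  obtain ⟨σ, hσ⟩ := exists_mapsBlock g.2.1 k
  exact ⟨σ q, h.translate g.2 (hσ q), fun h' => hn (h'.smul_of_mem g.2)⟩

end BlockModel

/-! ### The two choice principles and divisibility -/

section ChoicePrinciples

open ZFAUniverse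

variable {l : ℕ}

theorem exists_pow_of_dvd {p a n c : ℕ} (hp : p.Prime) (hn : p ^ a ∣ n) (h : c ∣ p ^ a) :
    ∃ e, c = p ^ e ∧ p ^ e ∣ n := by
  obtain ⟨e, -, rfl⟩ := (Nat.dvd_prime_pow hp).1 h
  exact ⟨e, rfl, h.trans hn⟩

theorem satisfiesRCfin_of_dvd {p a : Fin l → ℕ} (hp : ∀ k, (p k).Prime) {n : ℕ}
    (hn : ∀ k, p k ^ a k ∣ n) : (blockModel.{u} fun k => p k ^ a k).SatisfiesRCfin n := by
  intro x hx
  obtain ⟨hxa, hxi⟩ := isInfiniteSet_iff.1 hx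
  obtain ⟨T, hT⟩ := exists_supportedBy x.2
  obtain ⟨y, T', r, hya, hyx, hyi, hyT, horb⟩ :
      ∃ (y : (blockModel.{u} fun k => p k ^ a k).Dom) (T' : Finset (Fin l × ℚ)) (r : ℕ),
        ¬ IsAtom y.1 ∧ elts y.1 ⊆ elts x.1 ∧ (elts y.1).Infinite ∧
        SupportedBy (m := fun k => p k ^ a k) T' y.1 ∧
        ∀ w ∈ elts y.1, ∀ H ≤ fixBlocks (fun k => p k ^ a k) T', (MulAction.orbit H w).Finite →
          ∃ e, (MulAction.orbit H w).ncard = r ^ e ∧ r ^ e ∣ n := by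
    by_cases hall : ∀ w ∈ elts x.1, SupportedBy (m := fun k => p k ^ a k) T w
    -- All orbits are singletons here, so the base 2 is arbitrary and the exponent is 0.
    · exact ⟨x, T, 2, hxa, subset_rfl, hxi, hT, fun w hw H hH _ =>
        ⟨0, (hall w hw).ncard_orbit hH, one_dvd n⟩⟩
    · push Not at hall
      obtain ⟨x₀, hx₀, hx₀T⟩ := hall
      obtain ⟨S, hS⟩ := exists_supportedBy (x.2.of_mem hx₀)
      obtain ⟨T', k, q, hTT', hw, hnw⟩ := exists_critical_block hS hx₀T
      obtain ⟨y, hy, hya, hyx, hyi, hyT, hye⟩ := exists_orbit_dom x.2 hx₀ hT hTT' hnw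
      refine ⟨⟨y, hy⟩, T', p k, hya, hyx, hyi, hyT, fun w hwy H hH hfin => ?_⟩
      obtain ⟨q', h1, h2⟩ := exists_insert_supportedBy_of_mem_orbit hw hnw (hye ▸ hwy)
      exact exists_pow_of_dvd (hp k) (hn k) (card_orbit_dvd_of_finite h1 h2 hH hfin)
  have hsmall := small_elts y.1
  obtain ⟨f, hf, hfv⟩ := exists_choice_function_of_orbits
    (D := {z | ¬ IsAtom z ∧ elts z ⊆ elts y.1 ∧ (elts z).Finite ∧ n < (elts z).ncard})
    (T := T') (n := n)
    (small_of_injective (β := 𝒫 (elts y.1)) (f := fun z => ⟨elts z.1, z.2.2.1⟩) fun z w h =>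
      Subtype.ext (ext_of_not_isAtom z.2.1 w.2.1 (Subtype.mk.inj h)))
    (fun z hz => by
      rw [← ofSet_elts hz.1]
      exact hereditarilySymmetric_ofSet hz.2.2.1 fun w hw => y.2.of_mem (hz.2.1 hw))
    (fun z hz => hz.1) (fun z hz => hz.2.2.1) (fun z hz => hz.2.2.2)
    (fun π hπ z hz => by
      refine ⟨fun h => hz.1 (isAtom_smul.1 h), ?_, ?_, ?_⟩
      · rw [← hyT π hπ, elts_smul, elts_smul]
        exact Set.smul_set_mono hz.2.1
      · rw [elts_smul]
        exact hz.2.2.1.smul_set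
      · rw [elts_smul, ← Set.image_smul, Set.ncard_image_of_injective _ (MulAction.injective π)]
        exact hz.2.2.2)
    r (fun z hz w hw => horb w (hz.2.1 hw))
  refine ⟨y, subset_iff.2 ⟨hya, hxa, hyx⟩, isInfiniteSet_iff.2 ⟨hya, hyi⟩, f, ?_, hfv⟩
  convert hf using 2 with z
  refine (and_congr subset_iff isFiniteSetOfCardGT_iff).trans ?_
  constructor
  · rintro ⟨⟨h1, -, h2⟩, -, h3, h4⟩
    exact ⟨h1, h2, h3, h4⟩
  · rintro ⟨h1, h2, h3, h4⟩
    exact ⟨⟨h1, hya, h2⟩, h1, h3, h4⟩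

theorem satisfiesCminusfin_of_dvd {p a : Fin l → ℕ} (hp : ∀ k, (p k).Prime) {n : ℕ}
    (hn : ∀ k, p k ^ a k ∣ n) : (blockModel.{u} fun k => p k ^ a k).SatisfiesCminusfin n := by
  intro x hx hxc
  obtain ⟨hxa, hxi⟩ := isInfiniteSet_iff.1 hx
  have hxc' : ∀ z ∈ elts x.1, ¬ IsAtom z ∧ (elts z).Finite ∧ n < (elts z).ncard :=
    fun z hz => isFiniteSetOfCardGT_iff.1 (hxc ⟨z, x.2.of_mem hz⟩ hz)
  obtain ⟨T, hT⟩ := exists_supportedBy x.2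
  -- An element of a finite set inherits its supports, since its orbit stays in that set. Hence the
  -- critical block of a member `z` of the family also serves the elements of `z`.
  have hmem : ∀ z ∈ elts x.1, ∀ w ∈ elts z, ∀ T' : Finset (Fin l × ℚ),
      SupportedBy (m := fun k => p k ^ a k) T' z →
      SupportedBy (m := fun k => p k ^ a k) T' w := by
    intro z hz w hw T' hzT
    obtain ⟨S, hS⟩ := exists_supportedBy ((x.2.of_mem hz).of_mem hw)
    refine supportedBy_of_finite_orbit hS ((hxc' z hz).2.1.subset ?_)
    rintro _ ⟨g, rfl⟩
    exact smul_mem_elts (hzT g.1 g.2) hw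
  obtain ⟨y, T', r, hya, hyx, hyi, hyT, horb⟩ :
      ∃ (y : (blockModel.{u} fun k => p k ^ a k).Dom) (T' : Finset (Fin l × ℚ)) (r : ℕ),
        ¬ IsAtom y.1 ∧ elts y.1 ⊆ elts x.1 ∧ (elts y.1).Infinite ∧
        SupportedBy (m := fun k => p k ^ a k) T' y.1 ∧
        ∀ z ∈ elts y.1, ∀ w ∈ elts z, ∀ H ≤ fixBlocks (fun k => p k ^ a k) T',
          (MulAction.orbit H w).Finite →
          ∃ e, (MulAction.orbit H w).ncard = r ^ e ∧ r ^ e ∣ n := by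
    by_cases hall : ∀ z ∈ elts x.1, SupportedBy (m := fun k => p k ^ a k) T z
    · exact ⟨x, T, 2, hxa, subset_rfl, hxi, hT, fun z hz w hw H hH _ =>
        ⟨0, (hmem z hz w hw T (hall z hz)).ncard_orbit hH, one_dvd n⟩⟩
    · push Not at hall
      obtain ⟨x₀, hx₀, hx₀T⟩ := hall
      obtain ⟨S, hS⟩ := exists_supportedBy (x.2.of_mem hx₀)
      obtain ⟨T', k, q, hTT', hw, hnw⟩ := exists_critical_block hS hx₀T
      obtain ⟨y, hy, hya, hyx, hyi, hyT, hye⟩ := exists_orbit_dom x.2 hx₀ hT hTT' hnw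
      refine ⟨⟨y, hy⟩, T', p k, hya, hyx, hyi, hyT, fun z hz w hwz H hH hfin => ?_⟩
      obtain ⟨q', h1, -⟩ := exists_insert_supportedBy_of_mem_orbit hw hnw (hye ▸ hz)
      by_cases h2 : SupportedBy (m := fun k => p k ^ a k) T' w
      · exact ⟨0, h2.ncard_orbit hH, one_dvd n⟩
      · exact exists_pow_of_dvd (hp k) (hn k)
          (card_orbit_dvd_of_finite (hmem z (hyx hz) w hwz _ h1) h2 hH hfin)
  obtain ⟨f, hf, hfv⟩ := exists_choice_function_of_orbits (D := elts y.1) (T := T') (n := n)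
    (small_elts y.1) (fun z hz => y.2.of_mem hz) (fun z hz => (hxc' z (hyx hz)).1)
    (fun z hz => (hxc' z (hyx hz)).2.1) (fun z hz => (hxc' z (hyx hz)).2.2)
    (fun π hπ z hz => smul_mem_elts (hyT π hπ) hz) r horb
  exact ⟨y, subset_iff.2 ⟨hya, hxa, hyx⟩, isInfiniteSet_iff.2 ⟨hya, hyi⟩, f, hf, hfv⟩

variable {m : Fin l → ℕ}

/-- If `v` is a set of `n` objects out of the family `t` and each rotation of the second index
preserves `v`, then `n` is a multiple of the length of the cycles. -/
theorem dvd_of_rotation_invariant {ι : Type} [Finite ι] {k : ℕ} [NeZero k] {n : ℕ}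
    {t : ι × ZMod k → ZFAUniverse.{u} (BlockAtom m)} (ht : Function.Injective t)
    {v : ZFAUniverse.{u} (BlockAtom m)} (hv : (elts v).encard = n)
    (hsub : elts v ⊆ Set.range t) (hrot : ∀ i j, t (i, j) ∈ elts v → t (i, j + 1) ∈ elts v) :
    k ∣ n := by
  have h := dvd_ncard_of_rotation_invariant (S := t ⁻¹' elts v) hrot
  rwa [← Set.ncard_image_of_injective _ ht, Set.image_preimage_eq_of_subset hsub, Set.ncard,
    hv, ENat.toNat_natCast] at h

theorem dvd_of_satisfiesCminusfin (k : Fin l) [NeZero (m k)] {n : ℕ}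
    (h : (blockModel.{u} m).SatisfiesCminusfin n) : m k ∣ n := by
  -- Since a single block may have at most `n` elements, `n + 1` layers of it are taken.
  let t : ℚ → Fin (n + 1) × ZMod (m k) → ZFAUniverse.{u} (BlockAtom m) :=
    fun q x => nestedAtom ⟨k, q, x.2⟩ x.1
  have htinj : ∀ q q' x x', t q x = t q' x' → q = q' ∧ x = x' := by
    rintro q q' ⟨i, j⟩ ⟨i', j'⟩ h
    obtain ⟨h1, h2⟩ := nestedAtom_inj h
    simp only [Sigma.mk.injEq, heq_eq_eq, Prod.mk.injEq, true_and] at h1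
    exact ⟨h1.1, Prod.ext (Fin.ext h2) h1.2⟩
  have htinj' : ∀ q, Function.Injective (t q) := fun q x x' h => (htinj q q x x' h).2
  have htfin : ∀ q, (Set.range (t q)).Finite := fun q => Set.finite_range _
  let z : ℚ → ZFAUniverse.{u} (BlockAtom m) := fun q => ofSet (Set.range (t q))
  have hzelts : ∀ q, elts (z q) = Set.range (t q) := fun q => elts_ofSet (small_of_finite (htfin q))
  have hzHS : ∀ q, HereditarilySymmetric (blockGroup m) (z q) := by
    refine fun q => hereditarilySymmetric_ofSet (htfin q) ?_
    rintro _ ⟨x, rfl⟩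
    exact hereditarilySymmetric_nestedAtom _ _
  have hzinj : Function.Injective z := by
    intro q q' hqq
    have h1 : t q (0, 0) ∈ elts (z q') := by
      rw [← hqq, hzelts]
      exact ⟨_, rfl⟩
    rw [hzelts] at h1
    obtain ⟨x, hx⟩ := h1
    exact (htinj _ _ _ _ hx).1.symm
  have hzsub : ∀ (π : Equiv.Perm (BlockAtom m)) (q q' : ℚ), MapsBlock π k q q' → π • z q = z q' := by
    rintro π q q' ⟨e, he⟩
    change π • ofSet _ = ofSet _
    rw [smul_ofSet _ (small_of_finite (htfin q)), ← Set.image_smul, ← Set.range_comp]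
    congr 1
    have : (fun w => π • w) ∘ t q = t q' ∘ ((Equiv.refl _).prodCongr (Equiv.addRight e)) := by
      funext x
      change π • nestedAtom _ _ = nestedAtom _ _
      rw [smul_nestedAtom, he]
      rfl
    rw [this, (Equiv.surjective _).range_comp]
  have hsmall : Small.{u} (Set.range z) := small_range _
  have hFelts := elts_ofSet hsmall
  let F : (blockModel.{u} m).Dom := ⟨ofSet (Set.range z), by
    refine hereditarilySymmetric_of_fixed (fun π hπ => ?_) ?_
    · obtain ⟨σ, hσ⟩ := exists_mapsBlock hπ k
      rw [smul_ofSet _ hsmall, ← Set.image_smul, ← Set.range_comp]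
      congr 1
      have : (fun w => π • w) ∘ z = z ∘ σ := funext fun q => hzsub π q _ (hσ q)
      rw [this, σ.surjective.range_comp]
    · rw [hFelts]
      rintro _ ⟨q, rfl⟩
      exact hzHS q⟩
  have hFinf : (blockModel.{u} m).IsInfiniteSet F := by
    refine isInfiniteSet_iff.2 ⟨not_isAtom_ofSet _, ?_⟩
    change (elts (ofSet _)).Infinite
    rw [hFelts]
    exact Set.infinite_range_of_injective hzinj
  obtain ⟨B, hBF, hB, f, hf, hfv⟩ := h F hFinf (by
    intro w hw
    change w.1 ∈ elts (ofSet _) at hw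
    rw [hFelts] at hw
    obtain ⟨q, hq⟩ := hw
    refine isFiniteSetOfCardGT_iff.2 ?_
    rw [← hq, hzelts]
    refine ⟨not_isAtom_ofSet _, htfin q, ?_⟩
    rw [Set.ncard_range_of_injective (htinj' q), Nat.card_prod, Nat.card_fin, Nat.card_zmod]
    exact (Nat.lt_succ_self n).trans_le (Nat.le_mul_of_pos_right _ (NeZero.pos _)))
  obtain ⟨T, hT⟩ := exists_supportedBy f.2
  have hBsub : elts B.1 ⊆ Set.range z := (subset_iff.1 hBF).2.2.trans hFelts.subset
  have hQ : (z ⁻¹' elts B.1).Infinite :=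
    (isInfiniteSet_iff.1 hB).2.preimage hBsub
  -- A block outside the support of `f`, which may therefore be rotated freely.
  obtain ⟨q, hq, hqT⟩ := hQ.exists_notMem_finset (T.image Prod.snd)
  have hqT' : (k, q) ∉ T := fun h => hqT (Finset.mem_image_of_mem Prod.snd h)
  let zq : (blockModel.{u} m).Dom := ⟨z q, hzHS q⟩
  obtain ⟨v, hv, -⟩ := hf.2.2 zq hq
  obtain ⟨hvn, hvz⟩ := hfv _ _ hv
  have hfix : blockRotation k q 1 • v.1 = v.1 :=
    smul_value_eq hf (z := zq) hq hv (hT _ (blockRotation_mem_fixBlocks hqT' 1))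
      (hzsub _ q q ⟨1, blockRotation_apply k q 1⟩)
  refine dvd_of_rotation_invariant (htinj' q) (hasCard_iff.1 hvn).2
    ((subset_iff.1 hvz).2.2.trans (hzelts q).subset) fun i j hij => ?_
  have := smul_mem_elts hfix hij
  change blockRotation k q 1 • nestedAtom _ _ ∈ _ at this
  rwa [smul_nestedAtom, blockRotation_apply] at this

theorem dvd_of_satisfiesRCfin (k : Fin l) [NeZero (m k)] {n : ℕ}
    (h : (blockModel.{u} m).SatisfiesRCfin n) : m k ∣ n := by
  let t : ℚ × ZMod (m k) → ZFAUniverse.{u} (BlockAtom m) := fun x => atom ⟨k, x⟩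
  have htinj : Function.Injective t := fun x y h => by
    simpa only [Sigma.mk.injEq, heq_eq_eq, true_and] using atom_injective h
  have hsmall : Small.{u} (Set.range t) := small_range _
  have hxelts := elts_ofSet hsmall
  let x : (blockModel.{u} m).Dom := ⟨ofSet (Set.range t), by
    refine hereditarilySymmetric_of_fixed (fun π hπ => ?_) ?_
    · obtain ⟨σ, c, hσ⟩ := hπ
      rw [smul_ofSet _ hsmall, ← Set.image_smul, ← Set.range_comp]
      congr 1
      have hsurj : Function.Surjective
          (fun x : ℚ × ZMod (m k) => (σ k x.1, x.2 + c k x.1)) := by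
        rintro ⟨q, j⟩
        exact ⟨((σ k).symm q, j - c k ((σ k).symm q)), by simp⟩
      rw [← hsurj.range_comp t]
      congr 1
      funext y
      exact congrArg atom (hσ k y.1 y.2)
    · rw [hxelts]
      rintro _ ⟨y, rfl⟩
      exact hereditarilySymmetric_atom _⟩
  obtain ⟨y, hyx, hy, f, hf, hfv⟩ := h x (by
    refine isInfiniteSet_iff.2 ⟨not_isAtom_ofSet _, ?_⟩
    change (elts (ofSet _)).Infinite
    rw [hxelts]
    exact Set.infinite_range_of_injective htinj)
  obtain ⟨T₁, hT₁⟩ := exists_supportedBy y.2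
  obtain ⟨T₂, hT₂⟩ := exists_supportedBy f.2
  have hysub : elts y.1 ⊆ Set.range t := (subset_iff.1 hyx).2.2.trans hxelts.subset
  have hQ : (Prod.fst '' (t ⁻¹' elts y.1)).Infinite := by
    intro hfin
    refine (isInfiniteSet_iff.1 hy).2.preimage hysub 
      ((hfin.prod (Set.finite_univ (α := ZMod (m k)))).subset ?_)
    exact fun x hx => ⟨⟨x, hx, rfl⟩, trivial⟩
  -- Infinitely many blocks meet `y`, because each block is finite; `n + 1` of them avoiding both
  -- supports give a set with more than `n` atoms.
  obtain ⟨R, hR, hRcard⟩ :=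
    (hQ.sdiff ((T₁ ∪ T₂).image Prod.snd).finite_toSet).exists_subset_card_eq (n + 1)
  have hRT : ∀ q ∈ R, (k, q) ∉ T₁ ∧ (k, q) ∉ T₂ := by
    intro q hq
    have := (hR hq).2
    refine ⟨fun h => this ?_, fun h => this ?_⟩
    · exact Finset.mem_coe.2 (Finset.mem_image_of_mem Prod.snd (Finset.mem_union_left _ h))
    · exact Finset.mem_coe.2 (Finset.mem_image_of_mem Prod.snd (Finset.mem_union_right _ h))
  -- Rotations of a block outside the support of `y` preserve `y`, so one atom of the block in `y`
  -- brings in all the others.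
  have hfull : ∀ q ∈ R, ∀ j, t (q, j) ∈ elts y.1 := by
    intro q hq j
    obtain ⟨⟨q', j'⟩, hj', rfl⟩ := (hR hq).1
    have := smul_mem_elts (w := t (q', j'))
      (hT₁ _ (blockRotation_mem_fixBlocks (hRT _ hq).1 (j - j'))) hj'
    change blockRotation k q' (j - j') • atom _ ∈ _ at this
    rwa [smul_atom, blockRotation_apply, add_sub_cancel] at this
  let s : R × ZMod (m k) → ZFAUniverse.{u} (BlockAtom m) := fun x => t (x.1, x.2)
  have hsinj : Function.Injective s := by
    rintro ⟨q, j⟩ ⟨q', j'⟩ h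
    have := Prod.mk.inj (htinj h)
    exact Prod.ext (Subtype.ext this.1) this.2
  have hsfin : (Set.range s).Finite := Set.finite_range _
  have hzelts := elts_ofSet (small_of_finite hsfin)
  have hsy : Set.range s ⊆ elts y.1 := by
    rintro _ ⟨x, rfl⟩
    exact hfull _ x.1.2 _
  let z : (blockModel.{u} m).Dom := ⟨ofSet (Set.range s),
    hereditarilySymmetric_ofSet hsfin fun w hw => y.2.of_mem (hsy hw)⟩
  have hz : (blockModel.{u} m).Subset z y ∧ (blockModel.{u} m).IsFiniteSetOfCardGT z n := by
    refine ⟨subset_iff.2 ⟨not_isAtom_ofSet _, (isInfiniteSet_iff.1 hy).1,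
      hzelts.trans_subset hsy⟩, isFiniteSetOfCardGT_iff.2 ⟨not_isAtom_ofSet _, ?_⟩⟩
    change (elts (ofSet _)).Finite ∧ n < (elts (ofSet _)).ncard
    rw [hzelts, Set.ncard_range_of_injective hsinj, Nat.card_prod, Nat.card_zmod,
      Nat.card_eq_fintype_card, Fintype.card_coe, hRcard]
    exact ⟨hsfin, (Nat.lt_succ_self n).trans_le (Nat.le_mul_of_pos_right _ (NeZero.pos _))⟩
  obtain ⟨v, hv, -⟩ := hf.2.2 z hz
  obtain ⟨hvn, hvz⟩ := hfv _ _ hv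
  refine dvd_of_rotation_invariant hsinj (hasCard_iff.1 hvn).2
    ((subset_iff.1 hvz).2.2.trans hzelts.subset) fun q j hqj => ?_
  have hrz : blockRotation (m := m) k q.1 1 • z.1 = z.1 := by
    change blockRotation (m := m) k q.1 1 • ofSet _ = ofSet _
    rw [smul_ofSet _ (small_of_finite hsfin), ← Set.image_smul]
    congr 1
    refine Set.eq_of_subset_of_ncard_le ?_ ?_ hsfin
    · rintro _ ⟨_, ⟨⟨q', j'⟩, rfl⟩, rfl⟩
      change blockRotation (m := m) k q.1 1 • atom _ ∈ _
      rw [smul_atom]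
      by_cases hq' : q' = q
      · subst hq'
        rw [blockRotation_apply]
        exact ⟨(q', j' + 1), rfl⟩
      · rw [blockRotation_apply_of_ne _ fun h => hq' (Subtype.ext (Prod.mk.inj h).2)]
        exact ⟨(q', j'), rfl⟩
    · rw [Set.ncard_image_of_injective _ (MulAction.injective _)]
  have hfix : blockRotation (m := m) k q.1 1 • v.1 = v.1 :=
    smul_value_eq hf hz hv (hT₂ _ (blockRotation_mem_fixBlocks (hRT _ q.2).2 1)) hrz
  have := smul_mem_elts hfix hqj
  change blockRotation (m := m) k q.1 1 • atom _ ∈ _ at this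
  rwa [smul_atom, blockRotation_apply] at this

end ChoicePrinciples

theorem mainTheorem5 (l : ℕ) (p a : Fin l → ℕ) (hp : ∀ k, (p k).Prime)
    (hinj : Function.Injective p) (ha : ∀ k, 0 < a k) (n : ℕ) :
    ((blockModel.{u} fun k => p k ^ a k).SatisfiesRCfin n ↔
        (blockModel.{u} fun k => p k ^ a k).SatisfiesCminusfin n) ∧
      ((blockModel.{u} fun k => p k ^ a k).SatisfiesCminusfin n ↔
        (∏ k, p k ^ a k) ∣ n) := by
  have hne : ∀ k, NeZero (p k ^ a k) := fun k => ⟨pow_ne_zero _ (hp k).ne_zero⟩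
  have hdvd : (∏ k, p k ^ a k) ∣ n ↔ ∀ k, p k ^ a k ∣ n := by
    refine ⟨fun h k => (Finset.dvd_prod_of_mem _ (Finset.mem_univ k)).trans h, fun h => ?_⟩
    -- Powers of distinct primes are pairwise coprime.
    refine Fintype.prod_dvd_of_isRelPrime (fun i j hij => ?_) h
    exact Nat.coprime_iff_isRelPrime.1
      (Nat.Coprime.pow _ _ ((Nat.coprime_primes (hp i) (hp j)).2 (hinj.ne hij)))
  have hRC : (blockModel.{u} fun k => p k ^ a k).SatisfiesRCfin n ↔ ∀ k, p k ^ a k ∣ n :=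
    ⟨fun h k => dvd_of_satisfiesRCfin k h, satisfiesRCfin_of_dvd hp⟩
  have hC : (blockModel.{u} fun k => p k ^ a k).SatisfiesCminusfin n ↔ ∀ k, p k ^ a k ∣ n :=
    ⟨fun h k => dvd_of_satisfiesCminusfin k h, satisfiesCminusfin_of_dvd hp⟩
  exact ⟨hRC.trans hC.symm, hC.trans hdvd.symm⟩
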